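/- Let $M$ be a smooth paracompact Hausdorff $3$-manifold with an almost contact pseudo-metric structure $(\varphi,\xi,\eta,g)$: $\varphi$ is a smooth endomorphism field of $TM$, $\xi$ a smooth vector field, $\eta$ a smooth $1$-form and $g$ a smooth pseudo-Riemannian metric such that, with a constant $\varepsilon\in\{1,-1\}$, $$\varphi^2=-\mathrm{Id}+\eta\otimes\xi,\qquad \eta(\xi)=1,\qquad g(\varphi X,\varphi Y)=g(X,Y)-\varepsilon\,\eta(X)\eta(Y).$$ Let $\nabla$ be the Levi-Civita connection of $g$. Assume that the structure is quasi-Sasakian, that is: it is normal, $$[\varphi X,\varphi Y]-\varphi[\varphi X,Y]-\varphi[X,\varphi Y]+\varphi^2[X,Y]+\bigl(X(\eta(Y))-Y(\eta(X))-\eta([X,Y])\bigr)\xi=0$$ for all vector fields $X,Y$, and the functions $\alpha,\beta$ given by $2\varepsilon\alpha=\operatorname{trace}(X\mapsto\varphi\nabla_X\xi)$ and $2\varepsilon\beta=\operatorname{trace}(X\mapsto\nabla_X\xi)$ satisfy $\beta=0$ and $\xi(\alpha)=0$. Assume also that $\alpha(p)\neq0$ for every $p\in M$. Let $I\subseteq\mathbb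 R$ be an open interval and $\upsilon:I\to M$ a smooth curve with $g(\upsilon',\upsilon')=1$ that is non-geodesic, i.e. its geodesic curvature $\kappa=|g(\nabla_{\upsilon'}\upsilon',\nabla_{\upsilon'}\upsilon')|^{1/2}$ is positive everywhere on $I$. Let $T=\upsilon'$, $N$, $B$ be a smooth pseudo-orthonormal Frenet frame along $\upsilon$, with smooth geodesic torsion $\tau$, satisfying $$\nabla_TT=\kappa N,\qquad \nabla_TN=-\kappa T+\varepsilon\tau B,\qquad \nabla_TB=-\tau N,$$ and put $m=\eta(\upsilon')$. If $\tau(s)=|\alpha(\upsilon(s))|$ for all $s\in I$ and $m(s_0)=m'(s_0)=m''(s_0)=0$ for some $s_0\in I$, then $\upsilon$ is a Legendre curve, i.e. $m(s)=0$ for all $s\in I$. (Both cases $\varepsilon=1$, spacelike $\xi$, and $\varepsilon=-1$, timelike $\xi$, are included.) -/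

import Mathlib

open scoped Manifold ContDiff Bundle

noncomputable section

namespace ContactGeometry

/-- The model space of `3`-manifolds. -/
abbrev E3 : Type := EuclideanSpace ℝ (Fin 3)

/-- Coordinates of a tangent vector `p` in the frame given by the preferred chart at `x`.
At the base point `x` itself these coordinates are the identity map `T_x M = ℝ³`
(see `coord_self`). -/
def coord {M : Type*} [TopologicalSpace M] [ChartedSpace E3 M] [IsManifold (𝓡 3) ∞ M]
    (x : M) (p : TangentBundle (𝓡 3) M) : E3 :=
  letI : IsManifold (𝓡 3) 1 M := IsManifold.of_le (n := ∞) (by norm_cast)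
  (trivializationAt E3 (TangentSpace (𝓡 3) : M → Type _) x p).2

theorem coord_self {M : Type*} [TopologicalSpace M] [ChartedSpace E3 M] [IsManifold (𝓡 3) ∞ M]
    (x : M) (v : TangentSpace (𝓡 3) x) : coord x ⟨x, v⟩ = v := by
  have : IsManifold (𝓡 3) 1 M := IsManifold.of_le (n := ∞) (by norm_cast)
  exact (tangentBundleCore (𝓡 3) M).coordChange_self (achart E3 x) x
    (mem_chart_source E3 x) v

/-- The tangent vector at `y` with coordinates `v` in the frame given by the preferred chart at
`x` (for `y` in the domain of that chart). -/
def ofCoord {M : Type*} [TopologicalSpace M] [ChartedSpace E3 M] [IsManifold (𝓡 3) ∞ M]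
    (x y : M) : E3 →L[ℝ] TangentSpace (𝓡 3) y :=
  letI : IsManifold (𝓡 3) 1 M := IsManifold.of_le (n := ∞) (by norm_cast)
  (trivializationAt E3 (TangentSpace (𝓡 3) : M → Type _) x).symmL ℝ y

set_option synthInstance.maxHeartbeats 200000 in
/-- The Christoffel symbols `Γ_{ij}^k` at `u` of a field `G` of nondegenerate symmetric bilinear
forms on a vector space: `chartChristoffel G u w v = Γ(v, w)` is determined by
`2 G(Γ(v, w), z) = D_v G(w, z) + D_w G(v, z) - D_z G(w, v)` for all `z`. -/
def chartChristoffel {E : Type*} [NormedAddCommGroup E] [NormedSpace ℝ E]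
    (G : E → E →L[ℝ] E →L[ℝ] ℝ) (u w : E) : E →L[ℝ] E :=
  let D : E →L[ℝ] E →L[ℝ] E →L[ℝ] ℝ := fderiv ℝ G u
  (1 / 2 : ℝ) • ((G u).inverse ∘L (D.flip w + D w - (D.flip w).flip))

/-- The derivative `v(f)` of a function `f` along a tangent vector `v` at `x`. -/
def dirDeriv {M : Type*} [TopologicalSpace M] [ChartedSpace E3 M]
    (f : M → ℝ) (x : M) (v : TangentSpace (𝓡 3) x) : ℝ :=
  mfderiv (𝓡 3) 𝓘(ℝ, ℝ) f x v

/-- Velocity `υ'(s)` of a curve. -/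
def velocity {M : Type*} [TopologicalSpace M] [ChartedSpace E3 M]
    (υ : ℝ → M) (s : ℝ) : TangentSpace (𝓡 3) (υ s) :=
  mfderiv 𝓘(ℝ, ℝ) (𝓡 3) υ s (1 : ℝ)

/-- Smooth pseudo-Riemannian metrics on a `3`-manifold: smooth fields of nondegenerate symmetric
bilinear forms, of any signature. -/
structure PseudoMetric (M : Type*) [TopologicalSpace M] [ChartedSpace E3 M]
    [IsManifold (𝓡 3) ∞ M] where
  val (x : M) : TangentSpace (𝓡 3) x →L[ℝ] TangentSpace (𝓡 3) x →L[ℝ] ℝ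
  symm (x : M) (v w : TangentSpace (𝓡 3) x) : val x v w = val x w v
  nondeg (x : M) (v : TangentSpace (𝓡 3) x) : (∀ w, val x v w = 0) → v = 0
  smooth : ContMDiff (𝓡 3) ((𝓡 3).prod 𝓘(ℝ, E3 →L[ℝ] E3 →L[ℝ] ℝ)) ∞
    (fun x ↦ Bundle.TotalSpace.mk' (E3 →L[ℝ] E3 →L[ℝ] ℝ)
      (E := fun x : M ↦ TangentSpace (𝓡 3) x →L[ℝ] TangentSpace (𝓡 3) x →L[ℝ] ℝ) x (val x))

namespace PseudoMetric

variable {M : Type*} [TopologicalSpace M] [ChartedSpace E3 M] [IsManifold (𝓡 3) ∞ M]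

/-- The metric in the chart at `x`: the Gram form `g_{ij}(u)` at the point with coordinates
`u`. -/
def gram (g : PseudoMetric M) (x : M) (u : E3) : E3 →L[ℝ] E3 →L[ℝ] ℝ :=
  let y := (extChartAt (𝓡 3) x).symm u
  (ContinuousLinearMap.precomp ℝ (ofCoord x y)) ∘L (g.val y) ∘L (ofCoord x y)

/-- The Christoffel symbols of the Levi-Civita connection at `x`, in the chart at `x`. -/
def christoffel (g : PseudoMetric M) (x : M) (w : E3) : E3 →L[ℝ] E3 :=
  chartChristoffel (g.gram x) (extChartAt (𝓡 3) x x) w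

/-- The Levi-Civita covariant derivative of a vector field, `covDeriv Y x v = ∇_v Y`, in the chart
at `x`: `(∇_v Y)^k = v^i ∂_i Y^k + Γ_{ij}^k v^i Y^j`. -/
def covDeriv (g : PseudoMetric M) (Y : (x : M) → TangentSpace (𝓡 3) x) (x : M) :
    TangentSpace (𝓡 3) x →L[ℝ] TangentSpace (𝓡 3) x :=
  (fderiv ℝ (fun u : E3 ↦
      coord x ⟨(extChartAt (𝓡 3) x).symm u, Y ((extChartAt (𝓡 3) x).symm u)⟩)
    (extChartAt (𝓡 3) x x) + g.christoffel x (Y x) : E3 →L[ℝ] E3)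

/-- The Levi-Civita covariant derivative `∇_{υ'} V` of a vector field `V` along a curve `υ`, in
the chart at `υ(s)`: `(∇_{υ'} V)^k = (V^k)' + Γ_{ij}^k (υ')^i V^j`. -/
def covDerivAlong (g : PseudoMetric M) (υ : ℝ → M) (V : (s : ℝ) → TangentSpace (𝓡 3) (υ s))
    (s : ℝ) : TangentSpace (𝓡 3) (υ s) :=
  (deriv (fun t : ℝ ↦ coord (υ s) ⟨υ t, V t⟩) s
    + g.christoffel (υ s) (V s) (velocity υ s) : E3)

/-- The pseudo-norm `|v| = √|g(v, v)|`. -/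
def norm (g : PseudoMetric M) {x : M} (v : TangentSpace (𝓡 3) x) : ℝ := √|g.val x v v|

/-- The geodesic curvature `|∇_{υ'} υ'|` of a unit speed curve. -/
def curvature (g : PseudoMetric M) (υ : ℝ → M) (s : ℝ) : ℝ :=
  g.norm (g.covDerivAlong υ (velocity υ) s)

end PseudoMetric

/-- Almost contact pseudo-metric structures `(φ, ξ, η, g)` on a `3`-manifold, `ε = ±1` being the
causal character of `ξ`. -/
structure AlmostContactPseudoMetric (M : Type*) [TopologicalSpace M] [ChartedSpace E3 M]
    [IsManifold (𝓡 3) ∞ M] where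
  φ (x : M) : TangentSpace (𝓡 3) x →L[ℝ] TangentSpace (𝓡 3) x
  ξ (x : M) : TangentSpace (𝓡 3) x
  η (x : M) : TangentSpace (𝓡 3) x →L[ℝ] ℝ
  g : PseudoMetric M
  ε : ℝ
  φ_smooth : ContMDiff (𝓡 3) ((𝓡 3).prod 𝓘(ℝ, E3 →L[ℝ] E3)) ∞
    (fun x ↦ Bundle.TotalSpace.mk' (E3 →L[ℝ] E3)
      (E := fun x : M ↦ TangentSpace (𝓡 3) x →L[ℝ] TangentSpace (𝓡 3) x) x (φ x))
  ξ_smooth : ContMDiff (𝓡 3) (𝓡 3).tangent ∞ (fun x ↦ (⟨x, ξ x⟩ : TangentBundle (𝓡 3) M))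
  η_smooth : ContMDiff (𝓡 3) ((𝓡 3).prod 𝓘(ℝ, E3 →L[ℝ] ℝ)) ∞
    (fun x ↦ Bundle.TotalSpace.mk' (E3 →L[ℝ] ℝ)
      (E := fun x : M ↦ TangentSpace (𝓡 3) x →L[ℝ] ℝ) x (η x))
  ε_sq : ε ^ 2 = 1
  φ_sq (x : M) (v : TangentSpace (𝓡 3) x) : φ x (φ x v) = -v + η x v • ξ x
  η_ξ (x : M) : η x (ξ x) = 1
  compatible (x : M) (v w : TangentSpace (𝓡 3) x) :
    g.val x (φ x v) (φ x w) = g.val x v w - ε * η x v * η x w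

namespace AlmostContactPseudoMetric

variable {M : Type*} [TopologicalSpace M] [ChartedSpace E3 M] [IsManifold (𝓡 3) ∞ M]

/-- The Nijenhuis torsion
`N_φ(X, Y) = [φX, φY] - φ[φX, Y] + φ²[X, Y] - φ[X, φY]`. -/
def nijenhuis (Q : AlmostContactPseudoMetric M) (X Y : (x : M) → TangentSpace (𝓡 3) x) (x : M) :
    TangentSpace (𝓡 3) x :=
  VectorField.mlieBracket (𝓡 3) (fun y ↦ Q.φ y (X y)) (fun y ↦ Q.φ y (Y y)) x
    - Q.φ x (VectorField.mlieBracket (𝓡 3) (fun y ↦ Q.φ y (X y)) Y x)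
    + Q.φ x (Q.φ x (VectorField.mlieBracket (𝓡 3) X Y x))
    - Q.φ x (VectorField.mlieBracket (𝓡 3) X (fun y ↦ Q.φ y (Y y)) x)

/-- `2 dη(X, Y) = X(η(Y)) - Y(η(X)) - η([X, Y])`. -/
def twoDEta (Q : AlmostContactPseudoMetric M) (X Y : (x : M) → TangentSpace (𝓡 3) x) (x : M) :
    ℝ :=
  dirDeriv (fun y ↦ Q.η y (Y y)) x (X x)
    - dirDeriv (fun y ↦ Q.η y (X y)) x (Y x)
    - Q.η x (VectorField.mlieBracket (𝓡 3) X Y x)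

/-- Normality: `N_φ(X, Y) + 2 dη(X, Y) ξ = 0` at every point `x`, for all vector fields `X`, `Y`
that are smooth near `x`. -/
def IsNormal (Q : AlmostContactPseudoMetric M) : Prop :=
  ∀ (x : M) (X Y : (x : M) → TangentSpace (𝓡 3) x),
    ContMDiffAt (𝓡 3) (𝓡 3).tangent ∞ (fun y ↦ (⟨y, X y⟩ : TangentBundle (𝓡 3) M)) x →
    ContMDiffAt (𝓡 3) (𝓡 3).tangent ∞ (fun y ↦ (⟨y, Y y⟩ : TangentBundle (𝓡 3) M)) x →
    Q.nijenhuis X Y x + Q.twoDEta X Y x • Q.ξ x = 0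

/-- The function `α` of a normal structure, normalized by
`∇_X ξ = -ε α φX + ε β (X - η(X) ξ)`: `2 ε α = trace (X ↦ φ ∇_X ξ)`. -/
def α (Q : AlmostContactPseudoMetric M) (x : M) : ℝ :=
  Q.ε / 2 * LinearMap.trace ℝ (TangentSpace (𝓡 3) x)
    ((Q.φ x ∘L Q.g.covDeriv Q.ξ x : TangentSpace (𝓡 3) x →L[ℝ] TangentSpace (𝓡 3) x) :
      TangentSpace (𝓡 3) x →ₗ[ℝ] TangentSpace (𝓡 3) x)

/-- The function `β` of a normal structure, normalized by
`∇_X ξ = -ε α φX + ε β (X - η(X) ξ)`: `2 ε β = trace (X ↦ ∇_X ξ)`. -/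
def β (Q : AlmostContactPseudoMetric M) (x : M) : ℝ :=
  Q.ε / 2 * LinearMap.trace ℝ (TangentSpace (𝓡 3) x)
    (Q.g.covDeriv Q.ξ x : TangentSpace (𝓡 3) x →ₗ[ℝ] TangentSpace (𝓡 3) x)

/-- Quasi-Sasakian: normal with `β = 0` and `ξ(α) = 0`. -/
structure IsQuasiSasakian (Q : AlmostContactPseudoMetric M) : Prop where
  normal : Q.IsNormal
  beta_eq_zero : ∀ x, Q.β x = 0
  xi_alpha : ∀ x, dirDeriv Q.α x (Q.ξ x) = 0

/-- Smooth unit speed curves `υ : I → M` (spacelike: `g(υ', υ') = 1`). -/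
structure IsUnitSpeed (Q : AlmostContactPseudoMetric M) (I : Set ℝ) (υ : ℝ → M) : Prop where
  smooth : ContMDiffOn 𝓘(ℝ, ℝ) (𝓡 3) ∞ υ I
  unit : ∀ s ∈ I, Q.g.val (υ s) (velocity υ s) (velocity υ s) = 1

/-- Non-geodesic curves: the geodesic curvature is positive everywhere. -/
def IsNonGeodesic (Q : AlmostContactPseudoMetric M) (I : Set ℝ) (υ : ℝ → M) : Prop :=
  ∀ s ∈ I, 0 < Q.g.curvature υ s

/-- `(T = υ', N, B)` is a Frenet frame of the unit speed curve `υ` on `I`, with geodesic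
curvature `|∇_T T|` and geodesic torsion `τ`: a smooth pseudo-orthonormal frame with the
Frenet-Serret formulas
`∇_T T = κ N`, `∇_T N = -κ T + ε τ B`, `∇_T B = -τ N`. -/
structure IsFrenetFrame (Q : AlmostContactPseudoMetric M) (I : Set ℝ) (υ : ℝ → M)
    (N B : (s : ℝ) → TangentSpace (𝓡 3) (υ s)) (τ : ℝ → ℝ) : Prop where
  smooth_N : ContMDiffOn 𝓘(ℝ, ℝ) (𝓡 3).tangent ∞
    (fun s ↦ (⟨υ s, N s⟩ : TangentBundle (𝓡 3) M)) I
  smooth_B : ContMDiffOn 𝓘(ℝ, ℝ) (𝓡 3).tangent ∞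
    (fun s ↦ (⟨υ s, B s⟩ : TangentBundle (𝓡 3) M)) I
  smooth_τ : ContDiffOn ℝ ∞ τ I
  unit_N : ∀ s ∈ I, |Q.g.val (υ s) (N s) (N s)| = 1
  unit_B : ∀ s ∈ I, |Q.g.val (υ s) (B s) (B s)| = 1
  orth_TN : ∀ s ∈ I, Q.g.val (υ s) (velocity υ s) (N s) = 0
  orth_TB : ∀ s ∈ I, Q.g.val (υ s) (velocity υ s) (B s) = 0
  orth_NB : ∀ s ∈ I, Q.g.val (υ s) (N s) (B s) = 0
  deriv_T : ∀ s ∈ I, Q.g.covDerivAlong υ (velocity υ) s = Q.g.curvature υ s • N s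
  deriv_N : ∀ s ∈ I, Q.g.covDerivAlong υ N s
    = -(Q.g.curvature υ s • velocity υ s) + (Q.ε * τ s) • B s
  deriv_B : ∀ s ∈ I, Q.g.covDerivAlong υ B s = -(τ s • N s)

/-- Legendre curves: `η(υ') = 0`. -/
def IsLegendre (Q : AlmostContactPseudoMetric M) (I : Set ℝ) (υ : ℝ → M) : Prop :=
  ∀ s ∈ I, Q.η (υ s) (velocity υ s) = 0

end AlmostContactPseudoMetric

end ContactGeometry

end

/-!
Let `m`, `n`, `b` be the values of `η` on the Frenet frame `T`, `N`, `B`. The proof shows that the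
zeros of `(m, n, n')` form an open and closed subset of `I`.

*The characteristic field.* Normality, applied to `ξ` and an arbitrary field, says that the Lie
derivative of `η` along `ξ` vanishes and that of `φ` is killed by `φ`
(`IsNormal.lie_xi`). Differentiating the compatibility of `g` with `φ` and `η` along `ξ`, one finds
that the Lie derivative of `g` is `φ`-invariant (`lie_form_phi_invariant`). On the contact plane an
invariant symmetric form is determined by its trace, which is a multiple of `β = 0`; hence `∇ξ` is
skew, and `∇_X ξ = -ε α φ X` (`IsContactAlgebra.eq_smul_phi`, `IsQuasiSasakian.covDeriv_xi`).

*The structure equations.* As `η = ε g(·, ξ)` and the connection is compatible with the metric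
(`PseudoMetric.hasDerivAt_inner`), the Frenet formulas give
`m' = κ n` and `n' = -κ m + ε τ b - α g(φ T, N)`. They also force `g(N, N) = 1` and `g(B, B) = ε`
(`IsFrenetFrame.inner_self`), and in such a frame `g(φ T, N) = ± b` wherever `ε m ^ 2 ≠ 1`
(`IsContactAlgebra.inner_phi_sq`). With `τ = |α|` the term `ε τ b - α g(φ T, N)` is therefore, at
each point, either `0` or `2 ε τ b`.

*The conclusion.* At a zero of `(m, n, n')` one has `b = ± 1`, so the second value is excluded
there, and by continuity also nearby. Then `m' = κ n`, `n' = -κ m`, so `m ^ 2 + n ^ 2` is locally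
constant, hence zero (`eventually_eq_zero_of_frenet`). No regularity of the sign of `α` is
needed, but the argument uses the continuity of `κ`. Since the connection is defined at each
point in the chart of that point, this requires its independence of the chart, which is proved
for the acceleration through the Euler–Lagrange expression of the energy
(`lagrangeForm_pullback`, `PseudoMetric.two_mul_inner_covDerivAlong_velocity`).
-/

/-! ### Linear algebra of orthogonal frames and contact structures -/

namespace ContactGeometry

section LinearAlgebra

variable {V : Type*} [AddCommGroup V] [Module ℝ V] [TopologicalSpace V]

theorem linearIndependent_of_orthogonal {ι : Type*} (g : V →L[ℝ] V →L[ℝ] ℝ) (v : ι → V)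
    (ho : ∀ i j, i ≠ j → g (v i) (v j) = 0) (hn : ∀ i, g (v i) (v i) ≠ 0) :
    LinearIndependent ℝ v := by
  rw [linearIndependent_iff']
  intro s c hc i hi
  have h : g (∑ j ∈ s, c j • v j) (v i) = c i * g (v i) (v i) := by
    simp only [map_sum, map_smul, sum_apply, smul_apply,
      smul_eq_mul]
    refine Finset.sum_eq_single_of_mem i hi fun j _ hj ↦ ?_
    rw [ho j i hj, mul_zero]
  rw [hc] at h
  simp only [map_zero, zero_apply] at h
  exact (mul_eq_zero.mp h.symm).resolve_right (hn i)

theorem eq_sum_of_orthogonal (h3 : Module.finrank ℝ V = 3) (g : V →L[ℝ] V →L[ℝ] ℝ)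
    (v : Fin 3 → V) (ho : ∀ i j, i ≠ j → g (v i) (v j) = 0) (hn : ∀ i, g (v i) (v i) ≠ 0) (x : V) :
    x = ∑ i, (g x (v i) / g (v i) (v i)) • v i := by
  have hli := linearIndependent_of_orthogonal g v ho hn
  let b := basisOfLinearIndependentOfCardEqFinrank hli (by simp [h3])
  have hb : ∀ i, b i = v i := fun i ↦ by simp [b]
  have hx : x = ∑ i, b.repr x i • v i := by
    conv_lhs => rw [← b.sum_repr x]
    simp [hb]
  have hr : ∀ i, b.repr x i = g x (v i) / g (v i) (v i) := fun i ↦ by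
    rw [eq_div_iff (hn i)]
    conv_rhs => rw [hx]
    simp only [map_sum, map_smul, sum_apply, smul_apply,
      smul_eq_mul]
    rw [Finset.sum_eq_single_of_mem i (Finset.mem_univ i) fun j _ hj ↦ by rw [ho j i hj, mul_zero]]
  simpa only [hr] using hx

theorem trace_eq_sum_of_orthogonal (h3 : Module.finrank ℝ V = 3) (g : V →L[ℝ] V →L[ℝ] ℝ)
    (v : Fin 3 → V) (ho : ∀ i j, i ≠ j → g (v i) (v j) = 0) (hn : ∀ i, g (v i) (v i) ≠ 0)
    (f : V →ₗ[ℝ] V) :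
    LinearMap.trace ℝ V f = ∑ i, g (f (v i)) (v i) / g (v i) (v i) := by
  have hli := linearIndependent_of_orthogonal g v ho hn
  let b := basisOfLinearIndependentOfCardEqFinrank hli (by simp [h3])
  have hb : ∀ i, b i = v i := fun i ↦ by simp [b]
  rw [LinearMap.trace_eq_matrix_trace ℝ b, Matrix.trace]
  refine Finset.sum_congr rfl fun i _ ↦ ?_
  rw [Matrix.diag_apply, LinearMap.toMatrix_apply, hb]
  conv_lhs => rw [eq_sum_of_orthogonal h3 g v ho hn (f (v i))]
  simp only [← hb, map_sum, map_smul]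
  simp [Finsupp.single_apply]

/-- An orthogonal triple of non-null vectors in dimension three determines vectors. -/
theorem ext_of_orthogonal (h3 : Module.finrank ℝ V = 3) (g : V →L[ℝ] V →L[ℝ] ℝ)
    (v : Fin 3 → V) (ho : ∀ i j, i ≠ j → g (v i) (v j) = 0) (hn : ∀ i, g (v i) (v i) ≠ 0)
    {x y : V} (h : ∀ i, g x (v i) = g y (v i)) : x = y := by
  rw [eq_sum_of_orthogonal h3 g v ho hn x, eq_sum_of_orthogonal h3 g v ho hn y]
  simp only [h]

/-- An almost contact pseudo-metric structure `(φ, ξ, η, g)` on a vector space. -/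
structure IsContactAlgebra (g : V →L[ℝ] V →L[ℝ] ℝ) (φ : V →L[ℝ] V) (ξ : V) (η : V →L[ℝ] ℝ)
    (ε : ℝ) : Prop where
  symm : ∀ v w, g v w = g w v
  nondeg : ∀ v, (∀ w, g v w = 0) → v = 0
  ε_sq : ε ^ 2 = 1
  φ_sq : ∀ v, φ (φ v) = -v + η v • ξ
  η_ξ : η ξ = 1
  compatible : ∀ v w, g (φ v) (φ w) = g v w - ε * η v * η w

namespace IsContactAlgebra

variable {g : V →L[ℝ] V →L[ℝ] ℝ} {φ : V →L[ℝ] V} {ξ : V} {η : V →L[ℝ] ℝ} {ε : ℝ}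

theorem xi_ne_zero (h : IsContactAlgebra g φ ξ η ε) : ξ ≠ 0 := by
  intro h0
  have := h.η_ξ
  rw [h0, map_zero] at this
  exact zero_ne_one this

theorem phi_xi (h : IsContactAlgebra g φ ξ η ε) : φ ξ = 0 := by
  have h1 : φ (φ ξ) = 0 := by rw [h.φ_sq, h.η_ξ, one_smul, neg_add_cancel]
  have h2 : φ ξ = η (φ ξ) • ξ := by
    have := h.φ_sq (φ ξ)
    rw [h1, map_zero] at this
    exact eq_of_sub_eq_zero (neg_eq_zero.mp (by rw [neg_sub, sub_eq_neg_add, ← this]))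
  have h3 : (η (φ ξ) * η (φ ξ)) • ξ = 0 := by
    rw [mul_smul, ← h2, ← map_smul, ← h2, h1]
  have h4 : η (φ ξ) = 0 := mul_self_eq_zero.mp ((smul_eq_zero.mp h3).resolve_right h.xi_ne_zero)
  rw [h2, h4, zero_smul]

theorem eta_phi (h : IsContactAlgebra g φ ξ η ε) (v : V) : η (φ v) = 0 := by
  have h1 := h.φ_sq (φ v)
  rw [h.φ_sq v, map_add, map_neg, map_smul, h.phi_xi, smul_zero, add_zero, left_eq_add] at h1
  exact (smul_eq_zero.mp h1).resolve_right h.xi_ne_zero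

theorem inner_xi (h : IsContactAlgebra g φ ξ η ε) (v : V) : g v ξ = ε * η v := by
  have := h.compatible v ξ
  rw [h.phi_xi, map_zero, h.η_ξ] at this
  linarith

theorem inner_xi_xi (h : IsContactAlgebra g φ ξ η ε) : g ξ ξ = ε := by
  rw [h.inner_xi, h.η_ξ, mul_one]

theorem ε_ne_zero (h : IsContactAlgebra g φ ξ η ε) : ε ≠ 0 := by
  intro h0
  have := h.ε_sq
  simp [h0] at this

theorem inner_phi_phi_right (h : IsContactAlgebra g φ ξ η ε) (v w : V) :
    g (φ v) w = -g v (φ w) := by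
  have h1 := h.compatible v (φ w)
  rw [h.eta_phi, h.φ_sq, map_add, map_neg, map_smul, h.inner_xi, h.eta_phi] at h1
  simp only [mul_zero, smul_zero, add_zero, sub_zero] at h1
  linarith

theorem inner_phi_self (h : IsContactAlgebra g φ ξ η ε) (v : V) : g (φ v) v = 0 := by
  have h1 := h.inner_phi_phi_right v v
  rw [h.symm v (φ v)] at h1
  linarith

/-- The contact plane `ker η` contains a non-null vector. -/
theorem exists_nonnull (h : IsContactAlgebra g φ ξ η ε) (h3 : Module.finrank ℝ V = 3) :
    ∃ e, η e = 0 ∧ g e e ≠ 0 := by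
  by_contra! hc
  have hker : ∀ v, η v = 0 → v = 0 := fun v hv ↦ h.nondeg v fun w ↦ by
    have hw : η (w - η w • ξ) = 0 := by simp [h.η_ξ]
    have e1 : g v (w - η w • ξ) = g v w := by simp [h.inner_xi, hv]
    have e2 := hc (v + (w - η w • ξ)) (by rw [map_add, hv, hw, add_zero])
    have e3 : ∀ a b : V, g (a + b) (a + b) = g a a + g a b + (g b a + g b b) := fun a b ↦ by
      rw [map_add g, add_apply, map_add, map_add]
    rw [e3, hc _ hv, hc _ hw, h.symm (w - η w • ξ) v, e1] at e2
    linarith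
  have : Module.finrank ℝ V ≤ Module.finrank ℝ ℝ :=
    LinearMap.finrank_le_finrank_of_injective (f := (η : V →ₗ[ℝ] ℝ))
      ((injective_iff_map_eq_zero _).mpr hker)
  rw [h3, Module.finrank_self] at this
  omega

/-- An endomorphism `A` whose associated form `h(v, w) = g(A v, w) + g(v, A w)` is
`φ`-invariant, whose image is orthogonal to `ξ` and whose trace vanishes is the multiple
`-ε α φ` of `φ`, with `2 ε α = tr (φ A)`. Invariance leaves only the trace as a possible value of
`h` on the contact plane, so `A` is skew; a skew map of the plane is a multiple of `φ`. -/
theorem eq_smul_phi (h : IsContactAlgebra g φ ξ η ε) (h3 : Module.finrank ℝ V = 3)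
    (A : V →L[ℝ] V)
    (hinv : ∀ v w, g (A (φ v)) (φ w) + g (φ v) (A (φ w)) = g (A v) w + g v (A w))
    (hξ : ∀ v, g (A v) ξ = 0) (htr : LinearMap.trace ℝ V (A : V →ₗ[ℝ] V) = 0) (v : V) :
    A v = -(ε * (ε / 2 * LinearMap.trace ℝ V ((φ ∘L A : V →L[ℝ] V) : V →ₗ[ℝ] V))) • φ v := by
  obtain ⟨e, he, hq⟩ := h.exists_nonnull h3
  have hAξ : A ξ = 0 := h.nondeg _ fun w ↦ by
    have := hinv ξ w
    rw [h.phi_xi, map_zero, map_zero, zero_apply,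
      zero_apply, h.symm ξ (A w), hξ w] at this
    linarith
  have hφφ : φ (φ e) = -e := by rw [h.φ_sq, he, zero_smul, add_zero]
  have hqq : g (φ e) (φ e) = g e e := by rw [h.compatible, he, mul_zero, sub_zero]
  have hef : g (φ e) e = 0 := h.inner_phi_self e
  have hfe : g e (φ e) = 0 := by rw [h.symm, hef]
  have heξ : g e ξ = 0 := by rw [h.inner_xi, he, mul_zero]
  have hfξ : g (φ e) ξ = 0 := by rw [h.inner_xi, h.eta_phi, mul_zero]
  let b : Fin 3 → V := ![ξ, e, φ e]
  have hbo : ∀ i j, i ≠ j → g (b i) (b j) = 0 := by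
    intro i j hij
    fin_cases i <;> fin_cases j <;>
      simp [b, hef, hfe, heξ, hfξ, h.symm ξ] at hij ⊢
  have hbn : ∀ i, g (b i) (b i) ≠ 0 := by
    intro i
    fin_cases i
    · simpa [b, h.inner_xi_xi] using h.ε_ne_zero
    · simpa [b] using hq
    · simpa [b, hqq] using hq
  have hd := hinv e e
  have hm := hinv e (φ e)
  rw [hφφ] at hm
  simp only [map_neg] at hm
  have ht := htr
  rw [trace_eq_sum_of_orthogonal h3 g b hbo hbn, Fin.sum_univ_three] at ht
  simp only [b, Matrix.cons_val_zero, Matrix.cons_val_one, Matrix.cons_val,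
    ContinuousLinearMap.coe_coe, hAξ, map_zero, zero_apply, zero_div, zero_add,
    hqq] at ht
  rw [← add_div, div_eq_zero_iff, or_iff_left hq] at ht
  rw [h.symm (φ e) (A (φ e)), h.symm e (A e)] at hd
  rw [h.symm (φ e) (A e), h.symm e (A (φ e))] at hm
  have hee : g (A e) e = 0 := by linarith
  have hff : g (A (φ e)) (φ e) = 0 := by linarith
  have hfe' : g (A (φ e)) e = -g (A e) (φ e) := by linarith
  set c := g (A e) (φ e) / g e e with hc
  have hcq : c * g e e = g (A e) (φ e) := div_mul_cancel₀ _ hq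
  have hAe : A e = c • φ e := by
    refine ext_of_orthogonal h3 g b hbo hbn fun i ↦ ?_
    fin_cases i
    · simp [b, hξ, hfξ]
    · simp [b, hee, hef]
    · simp [b, hqq, hcq]
  have hAf : A (φ e) = -(c • e) := by
    refine ext_of_orthogonal h3 g b hbo hbn fun i ↦ ?_
    fin_cases i
    · simp [b, hξ, heξ]
    · simp [b, hfe', hcq]
    · simp [b, hff, hfe]
  have htφ : LinearMap.trace ℝ V ((φ ∘L A : V →L[ℝ] V) : V →ₗ[ℝ] V) = -2 * c := by
    rw [trace_eq_sum_of_orthogonal h3 g b hbo hbn, Fin.sum_univ_three]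
    simp only [b, Matrix.cons_val_zero, Matrix.cons_val_one, Matrix.cons_val,
      ContinuousLinearMap.coe_coe, ContinuousLinearMap.comp_apply, hAξ, hAe, hAf, map_zero,
      map_smul, map_neg, hφφ, zero_apply, neg_apply,
      smul_apply, smul_eq_mul, hqq]
    field_simp
    ring
  rw [htφ]
  have hcc : -(ε * (ε / 2 * (-2 * c))) = c := by linear_combination c * h.ε_sq
  rw [hcc]
  conv_lhs => rw [eq_sum_of_orthogonal h3 g b hbo hbn v]
  conv_rhs => rw [eq_sum_of_orthogonal h3 g b hbo hbn v]
  simp only [Fin.sum_univ_three, b, Matrix.cons_val_zero, Matrix.cons_val_one, Matrix.cons_val,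
    map_add, map_smul, hAξ, hAe, hAf, h.phi_xi, hφφ]
  module

/-- The components of a vector in a pseudo-orthonormal frame with signature `(1, 1, ε)`. -/
theorem eq_sum_frame (h : IsContactAlgebra g φ ξ η ε) (h3 : Module.finrank ℝ V = 3)
    {T N B : V} (hTT : g T T = 1) (hNN : g N N = 1) (hBB : g B B = ε) (hTN : g T N = 0)
    (hTB : g T B = 0) (hNB : g N B = 0) (x : V) :
    x = g x T • T + g x N • N + (ε * g x B) • B := by
  let b : Fin 3 → V := ![T, N, B]
  have hbo : ∀ i j, i ≠ j → g (b i) (b j) = 0 := by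
    intro i j hij
    fin_cases i <;> fin_cases j <;>
      simp [b, hTN, hTB, hNB, h.symm N T, h.symm B T, h.symm B N] at hij ⊢
  have hbn : ∀ i, g (b i) (b i) ≠ 0 := by
    intro i
    fin_cases i
    · simp [b, hTT]
    · simp [b, hNN]
    · simpa [b, hBB] using h.ε_ne_zero
  have hdiv : ∀ r : ℝ, r / ε = ε * r := fun r ↦ by
    rw [div_eq_iff h.ε_ne_zero]
    linear_combination -r * h.ε_sq
  have hx := eq_sum_of_orthogonal h3 g b hbo hbn x
  simpa only [Fin.sum_univ_three, b, Matrix.cons_val_zero, Matrix.cons_val_one, Matrix.cons_val,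
    hTT, hNN, hBB, div_one, hdiv] using hx

/-- The relation `g(ξ, ξ) = ε`, in components. -/
theorem eta_frame (h : IsContactAlgebra g φ ξ η ε) (h3 : Module.finrank ℝ V = 3)
    {T N B : V} (hTT : g T T = 1) (hNN : g N N = 1) (hBB : g B B = ε) (hTN : g T N = 0)
    (hTB : g T B = 0) (hNB : g N B = 0) :
    ε * η T ^ 2 + ε * η N ^ 2 + η B ^ 2 = 1 := by
  have h1 := congrArg η (h.eq_sum_frame h3 hTT hNN hBB hTN hTB hNB ξ)
  simp only [h.symm ξ, h.inner_xi, h.η_ξ, map_add, map_smul, smul_eq_mul] at h1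
  linear_combination -h1 - η B ^ 2 * h.ε_sq

/-- In a pseudo-orthonormal frame `T, N, B` with `g(T, T) = g(N, N) = 1`, `g(B, B) = ε`, the
`N`-component of `φ T` agrees up to sign with the `B`-component of `ξ`: this is the orientation
ambiguity of the relation `φ T = ± ξ × T`. -/
theorem inner_phi_sq (h : IsContactAlgebra g φ ξ η ε) (h3 : Module.finrank ℝ V = 3)
    {T N B : V} (hTT : g T T = 1) (hNN : g N N = 1) (hBB : g B B = ε) (hTN : g T N = 0)
    (hTB : g T B = 0) (hNB : g N B = 0) (hm : 1 - ε * η T ^ 2 ≠ 0) :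
    g (φ T) N ^ 2 = η B ^ 2 := by
  have e2 := h.ε_sq
  have h1 := h.eta_frame h3 hTT hNN hBB hTN hTB hNB
  have hφ := h.eq_sum_frame h3 hTT hNN hBB hTN hTB hNB (φ T)
  rw [h.inner_phi_self, zero_smul, zero_add] at hφ
  have h2 := congrArg η hφ
  have h4 := h.compatible T T
  have h5 : g (φ T) (φ T) = g (φ T) N ^ 2 + ε * g (φ T) B ^ 2 := by
    conv_lhs => rw [hφ]
    simp only [map_add, map_smul, add_apply, smul_apply,
      smul_eq_mul, hNN, hBB, hNB, h.symm B N]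
    linear_combination ε * g (φ T) B ^ 2 * e2
  rw [h5, hTT] at h4
  simp only [h.eta_phi, map_add, map_smul, smul_eq_mul] at h2
  generalize g (φ T) N = p at *
  generalize g (φ T) B = q at *
  generalize η T = m at *
  generalize η N = n at *
  generalize η B = b at *
  -- `q b = -ε p n` turns the norm of `φ T` into a multiple of `p ^ 2`
  have h6 : (1 - ε * m ^ 2) * (p ^ 2 - b ^ 2) = 0 := by
    have hqb : q * b = -(ε * (p * n)) := by linear_combination -ε * h2 - q * b * e2
    have hk : b ^ 2 * (p ^ 2 + ε * q ^ 2) = p ^ 2 * (b ^ 2 + ε * n ^ 2) := by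
      linear_combination ε * (q * b - ε * (p * n)) * hqb + ε * p ^ 2 * n ^ 2 * e2
    linear_combination -hk - p ^ 2 * h1 + b ^ 2 * h4
  have := (mul_eq_zero.mp h6).resolve_left hm
  linarith

end IsContactAlgebra

end LinearAlgebra

end ContactGeometry

/-! ### Tangent vectors and metrics in charts -/

namespace ContactGeometry

section Charts

open Filter Topology Set

variable {M : Type*} [TopologicalSpace M] [ChartedSpace E3 M]

theorem extChartAt_target_mem_nhds' {x : M} {u : E3} (hu : u ∈ (extChartAt (𝓡 3) x).target) :
    (extChartAt (𝓡 3) x).target ∈ 𝓝 u :=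
  (isOpen_extChartAt_target x).mem_nhds hu

theorem symm_mem_source {x : M} {u : E3} (hu : u ∈ (extChartAt (𝓡 3) x).target) :
    (extChartAt (𝓡 3) x).symm u ∈ (chartAt E3 x).source := by
  simpa using (extChartAt (𝓡 3) x).map_target hu

variable [IsManifold (𝓡 3) ∞ M]

theorem ofCoord_coord {x y : M} (hy : y ∈ (chartAt E3 x).source) (v : TangentSpace (𝓡 3) y) :
    ofCoord x y (coord x ⟨y, v⟩) = v := by
  have : IsManifold (𝓡 3) 1 M := IsManifold.of_le (n := ∞) (by norm_cast)
  unfold ofCoord coord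
  have hb : y ∈ (trivializationAt E3 (TangentSpace (𝓡 3) : M → Type _) x).baseSet := by
    simpa using hy
  rw [Bundle.Trivialization.symmL_apply (hb := hb)]
  exact (trivializationAt E3 (TangentSpace (𝓡 3) : M → Type _) x).symm_apply_apply_mk
    (by simpa using hy) v

theorem coord_ofCoord {x y : M} (hy : y ∈ (chartAt E3 x).source) (v : E3) :
    coord x ⟨y, ofCoord x y v⟩ = v := by
  have : IsManifold (𝓡 3) 1 M := IsManifold.of_le (n := ∞) (by norm_cast)
  unfold ofCoord coord
  have hb : y ∈ (trivializationAt E3 (TangentSpace (𝓡 3) : M → Type _) x).baseSet := by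
    simpa using hy
  rw [Bundle.Trivialization.symmL_apply (hb := hb)]
  have h := (trivializationAt E3 (TangentSpace (𝓡 3) : M → Type _) x).apply_mk_symm
    (b := y) (by simpa using hy) v
  exact congrArg Prod.snd h

theorem ofCoord_self (x : M) (v : TangentSpace (𝓡 3) x) : ofCoord x x v = v := by
  have h := ofCoord_coord (mem_chart_source E3 x) v
  rw [coord_self] at h
  exact h

theorem coord_eq_mfderiv {x y : M} (hy : y ∈ (chartAt E3 x).source) (v : TangentSpace (𝓡 3) y) :
    coord x ⟨y, v⟩ = mfderiv (𝓡 3) 𝓘(ℝ, E3) (extChartAt (𝓡 3) x) y v := by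
  have : IsManifold (𝓡 3) 1 M := IsManifold.of_le (n := ∞) (by norm_cast)
  have h := TangentBundle.continuousLinearMapAt_trivializationAt (𝕜 := ℝ) (I := 𝓡 3) hy
  refine Eq.trans ?_ (DFunLike.congr_fun h v)
  rw [Bundle.Trivialization.continuousLinearMapAt_apply,
    Bundle.Trivialization.linearMapAt_apply, if_pos (by simpa using hy)]
  rfl

theorem ofCoord_eq_mfderiv {x : M} {u : E3} (hu : u ∈ (extChartAt (𝓡 3) x).target) (v : E3) :
    ofCoord x ((extChartAt (𝓡 3) x).symm u) v =
      mfderiv 𝓘(ℝ, E3) (𝓡 3) (extChartAt (𝓡 3) x).symm u v := by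
  have : IsManifold (𝓡 3) 1 M := IsManifold.of_le (n := ∞) (by norm_cast)
  have hy : (extChartAt (𝓡 3) x).symm u ∈ (chartAt E3 x).source := by
    simpa using (extChartAt (𝓡 3) x).map_target hu
  have h := TangentBundle.symmL_trivializationAt (𝕜 := ℝ) (I := 𝓡 3) hy
  rw [(extChartAt (𝓡 3) x).right_inv hu] at h
  have h2 : mfderivWithin 𝓘(ℝ, E3) (𝓡 3) (extChartAt (𝓡 3) x).symm (range (𝓡 3)) u =
    mfderiv 𝓘(ℝ, E3) (𝓡 3) (extChartAt (𝓡 3) x).symm u := by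
    rw [modelWithCornersSelf_coe, range_id, mfderivWithin_univ]
  rw [← h2, ← h]
  rfl

theorem contMDiffAt_symm {x : M} {u : E3} (hu : u ∈ (extChartAt (𝓡 3) x).target) :
    ContMDiffAt 𝓘(ℝ, E3) (𝓡 3) ∞ (extChartAt (𝓡 3) x).symm u :=
  (contMDiffOn_extChartAt_symm x).contMDiffAt (extChartAt_target_mem_nhds' hu)

/-- Smoothness of a vector field along a map, read in the chart at any point `x`. -/
theorem contMDiffAt_iff_coord {F H P : Type*} [NormedAddCommGroup F] [NormedSpace ℝ F]
    [TopologicalSpace H] {J : ModelWithCorners ℝ F H} [TopologicalSpace P] [ChartedSpace H P]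
    {f : P → M} {V : (p : P) → TangentSpace (𝓡 3) (f p)} {p : P} {x : M}
    (hp : f p ∈ (chartAt E3 x).source) :
    ContMDiffAt J (𝓡 3).tangent ∞ (fun q ↦ (⟨f q, V q⟩ : TangentBundle (𝓡 3) M)) p ↔
      ContMDiffAt J (𝓡 3) ∞ f p ∧
      ContMDiffAt J 𝓘(ℝ, E3) ∞ (fun q ↦ coord x ⟨f q, V q⟩) p := by
  have : IsManifold (𝓡 3) 1 M := IsManifold.of_le (n := ∞) (by norm_cast)
  have : IsManifold (𝓡 3) (∞ + 1) M := by simpa using ‹IsManifold (𝓡 3) ∞ M›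
  exact (trivializationAt E3 (TangentSpace (𝓡 3) : M → Type _) x).contMDiffAt_iff
    (n := ∞) (IB := 𝓡 3) (f := fun q ↦ (⟨f q, V q⟩ : TangentBundle (𝓡 3) M))
    ((trivializationAt E3 (TangentSpace (𝓡 3) : M → Type _) x).mem_source.mpr (by simpa using hp))

theorem contMDiffAt_ofCoord_symm {x : M} {u : E3} (hu : u ∈ (extChartAt (𝓡 3) x).target)
    (v : E3) :
    ContMDiffAt 𝓘(ℝ, E3) (𝓡 3).tangent ∞
      (fun w ↦ (⟨(extChartAt (𝓡 3) x).symm w, ofCoord x ((extChartAt (𝓡 3) x).symm w) v⟩ :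
        TangentBundle (𝓡 3) M)) u := by
  rw [contMDiffAt_iff_coord (symm_mem_source hu)]
  refine ⟨contMDiffAt_symm hu, contMDiffAt_const (c := v) |>.congr_of_eventuallyEq ?_⟩
  filter_upwards [extChartAt_target_mem_nhds' hu] with w hw
  exact coord_ofCoord (symm_mem_source hw) v

/-- The field with constant coordinates `v` in the chart at `x` is smooth near `x`. -/
theorem contMDiffAt_ofCoord (x : M) (v : E3) :
    ContMDiffAt (𝓡 3) (𝓡 3).tangent ∞
      (fun y ↦ (⟨y, ofCoord x y v⟩ : TangentBundle (𝓡 3) M)) x := by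
  rw [contMDiffAt_iff_coord (mem_chart_source E3 x)]
  refine ⟨contMDiffAt_id, contMDiffAt_const (c := v) |>.congr_of_eventuallyEq ?_⟩
  filter_upwards [(chartAt E3 x).open_source.mem_nhds (mem_chart_source E3 x)] with w hw
  exact coord_ofCoord hw v

/-- A map into continuous linear maps out of a finite-dimensional space is smooth at a point if
all its values at fixed vectors are smooth there. -/
theorem contDiffAt_clm_of_apply {D E F : Type*} [NormedAddCommGroup D] [NormedSpace ℝ D]
    [NormedAddCommGroup E] [NormedSpace ℝ E] [FiniteDimensional ℝ E] [NormedAddCommGroup F]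
    [NormedSpace ℝ F] {n : ℕ∞ω} {f : D → E →L[ℝ] F} {u : D}
    (h : ∀ v, ContDiffAt ℝ n (fun w ↦ f w v) u) : ContDiffAt ℝ n f u := by
  let d := Module.finrank ℝ E
  have hd : d = Module.finrank ℝ (Fin d → ℝ) := (Module.finrank_fin_fun ℝ).symm
  let e₁ := ContinuousLinearEquiv.ofFinrankEq hd
  let e₂ := (e₁.arrowCongr (1 : F ≃L[ℝ] F)).trans (ContinuousLinearEquiv.piRing (Fin d))
  rw [← Function.id_comp f, ← e₂.symm_comp_self]
  exact e₂.symm.contDiff.contDiffAt.comp u (contDiffAt_pi.mpr fun i ↦ h _)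

variable (g : PseudoMetric M)

theorem PseudoMetric.gram_apply (x : M) (u v w : E3) :
    g.gram x u v w = g.val ((extChartAt (𝓡 3) x).symm u)
      (ofCoord x ((extChartAt (𝓡 3) x).symm u) v)
      (ofCoord x ((extChartAt (𝓡 3) x).symm u) w) := rfl

/-- Smooth vector fields along a map have a smooth inner product. -/
theorem PseudoMetric.contMDiffAt_inner {F H P : Type*} [NormedAddCommGroup F] [NormedSpace ℝ F]
    [TopologicalSpace H] {J : ModelWithCorners ℝ F H} [TopologicalSpace P] [ChartedSpace H P]
    {f : P → M} {V W : (p : P) → TangentSpace (𝓡 3) (f p)} {p : P}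
    (hV : ContMDiffAt J (𝓡 3).tangent ∞ (fun q ↦ (⟨f q, V q⟩ : TangentBundle (𝓡 3) M)) p)
    (hW : ContMDiffAt J (𝓡 3).tangent ∞ (fun q ↦ (⟨f q, W q⟩ : TangentBundle (𝓡 3) M)) p) :
    ContMDiffAt J 𝓘(ℝ, ℝ) ∞ (fun q ↦ g.val (f q) (V q) (W q)) p := by
  have : IsManifold (𝓡 3) 1 M := IsManifold.of_le (n := ∞) (by norm_cast)
  have hf : ContMDiffAt J (𝓡 3) ∞ f p :=
    ((contMDiffAt_iff_coord (mem_chart_source E3 (f p))).mp hV).1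
  have hg := (g.smooth (f p)).comp p hf
  have := ContMDiffAt.clm_bundle_apply₂ (F₁ := E3) (F₂ := E3) (F₃ := ℝ)
    (E₁ := fun x : M ↦ TangentSpace (𝓡 3) x) (E₂ := fun x : M ↦ TangentSpace (𝓡 3) x)
    (E₃ := Bundle.Trivial M ℝ) (n := ∞) (IB := 𝓡 3) (IM := J) (b := f)
    (ψ := fun q ↦ g.val (f q)) (v := V) (w := W) (x := p) hg hV hW
  rw [Bundle.contMDiffAt_totalSpace] at this
  exact this.2

theorem PseudoMetric.contDiffAt_gram {x : M} {u : E3} (hu : u ∈ (extChartAt (𝓡 3) x).target) :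
    ContDiffAt ℝ ∞ (g.gram x) u :=
  contDiffAt_clm_of_apply fun v ↦ contDiffAt_clm_of_apply fun w ↦ contMDiffAt_iff_contDiffAt.mp
    (g.contMDiffAt_inner (contMDiffAt_ofCoord_symm hu v) (contMDiffAt_ofCoord_symm hu w))

theorem PseudoMetric.inner_eq_gram {x y : M} (hy : y ∈ (chartAt E3 x).source)
    (v w : TangentSpace (𝓡 3) y) :
    g.val y v w = g.gram x (extChartAt (𝓡 3) x y) (coord x ⟨y, v⟩) (coord x ⟨y, w⟩) := by
  rw [g.gram_apply]
  have h : (extChartAt (𝓡 3) x).symm (extChartAt (𝓡 3) x y) = y :=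
    (extChartAt (𝓡 3) x).left_inv (by simpa using hy)
  rw [h, ofCoord_coord hy, ofCoord_coord hy]

/-- At the base point, the Gram form is the metric: coordinates at `x` are those of `T_x M`. -/
theorem PseudoMetric.gram_self (x : M) (v w : TangentSpace (𝓡 3) x) :
    g.gram x (extChartAt (𝓡 3) x x) v w = g.val x v w := by
  rw [g.inner_eq_gram (mem_chart_source E3 x), coord_self, coord_self]

theorem PseudoMetric.gram_symm (x : M) (u v w : E3) : g.gram x u v w = g.gram x u w v := by
  rw [g.gram_apply, g.gram_apply, g.symm]

theorem coord_velocity {υ : ℝ → M} {t : ℝ} {x : M} (hx : υ t ∈ (chartAt E3 x).source)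
    (hυ : MDifferentiableAt 𝓘(ℝ, ℝ) (𝓡 3) υ t) :
    HasDerivAt (fun r ↦ extChartAt (𝓡 3) x (υ r)) (coord x ⟨υ t, velocity υ t⟩) t := by
  have : IsManifold (𝓡 3) 1 M := IsManifold.of_le (n := ∞) (by norm_cast)
  rw [coord_eq_mfderiv hx]
  have h1 : HasMFDerivAt 𝓘(ℝ, ℝ) 𝓘(ℝ, E3) (extChartAt (𝓡 3) x ∘ υ) t _ :=
    (mdifferentiableAt_extChartAt hx).hasMFDerivAt.comp t hυ.hasMFDerivAt
  exact HasFDerivAt.hasDerivAt (𝕜 := ℝ) (F := E3) h1.hasFDerivAt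

end Charts

end ContactGeometry

/-! ### The Levi-Civita connection in charts -/

namespace ContactGeometry

section Connection

open Filter Topology Set

theorem eventually_mem_chart {M : Type*} [TopologicalSpace M] [ChartedSpace E3 M] {υ : ℝ → M}
    {s : ℝ} {x : M} (hx : υ s ∈ (chartAt E3 x).source) (hυ : ContinuousAt υ s) :
    ∀ᶠ t in 𝓝 s, υ t ∈ (chartAt E3 x).source :=
  hυ.preimage_mem_nhds ((chartAt E3 x).open_source.mem_nhds hx)

section VectorSpace

variable {E : Type*} [NormedAddCommGroup E] [NormedSpace ℝ E]

theorem isInvertible_of_nondegenerate [FiniteDimensional ℝ E] (B : E →L[ℝ] E →L[ℝ] ℝ)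
    (hB : ∀ v, (∀ w, B v w = 0) → v = 0) : B.IsInvertible := by
  have hinj : Function.Injective (B : E →ₗ[ℝ] E →L[ℝ] ℝ) :=
    (injective_iff_map_eq_zero _).mpr fun v hv ↦ hB v fun w ↦ by
      have : B v = 0 := hv
      rw [this, zero_apply]
  have hdim : Module.finrank ℝ E = Module.finrank ℝ (E →L[ℝ] ℝ) := by
    rw [← (LinearMap.toContinuousLinearMap (𝕜 := ℝ) (E := E) (F' := ℝ)).finrank_eq]
    exact (Subspace.dual_finrank_eq (K := ℝ) (V := E)).symm
  refine ⟨(LinearEquiv.ofInjectiveOfFinrankEq _ hinj hdim).toContinuousLinearEquiv, ?_⟩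
  ext v w
  rfl

theorem two_mul_inner_chartChristoffel [FiniteDimensional ℝ E] {G : E → E →L[ℝ] E →L[ℝ] ℝ} {u : E}
    (hnd : ∀ v, (∀ w, G u v w = 0) → v = 0) (v w z : E) :
    2 * G u (chartChristoffel G u w v) z =
      fderiv ℝ G u v w z + fderiv ℝ G u w v z - fderiv ℝ G u z w v := by
  obtain ⟨e, he⟩ := isInvertible_of_nondegenerate (G u) hnd
  have h : ∀ f : E →L[ℝ] ℝ, G u ((G u).inverse f) = f := fun f ↦ by
    rw [← he, ContinuousLinearMap.inverse_equiv]
    exact e.apply_symm_apply f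
  simp only [chartChristoffel, smul_apply, ContinuousLinearMap.comp_apply, map_smul, h, sub_apply,
    add_apply, ContinuousLinearMap.flip_apply, smul_eq_mul]
  ring

theorem fderiv_form_symm {G : E → E →L[ℝ] E →L[ℝ] ℝ} {u : E} (hG : DifferentiableAt ℝ G u)
    (hs : ∀ u v w, G u v w = G u w v) (a v w : E) : fderiv ℝ G u a v w = fderiv ℝ G u a w v := by
  have h : ∀ v w, HasFDerivAt (fun x ↦ G x v w) ((fderiv ℝ G u).flip v |>.flip w) u := fun v w ↦
    (((hG.hasFDerivAt.clm_apply (hasFDerivAt_const v u)).clm_apply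
      (hasFDerivAt_const w u))).congr_fderiv (by ext; simp)
  have h2 := h w v
  simp only [hs _ w v] at h2
  exact DFunLike.congr_fun ((h v w).unique h2) a

set_option synthInstance.maxHeartbeats 200000 in
/-- The derivative of `G(V, W)` along a curve `c`. -/
theorem hasDerivAt_form {G : E → E →L[ℝ] E →L[ℝ] ℝ} {c V W : ℝ → E} {c' V' W' : E} {s : ℝ}
    (hG : DifferentiableAt ℝ G (c s)) (hc : HasDerivAt c c' s) (hV : HasDerivAt V V' s)
    (hW : HasDerivAt W W' s) :
    HasDerivAt (fun t ↦ G (c t) (V t) (W t))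
      (fderiv ℝ G (c s) c' (V s) (W s) + G (c s) V' (W s) + G (c s) (V s) W') s := by
  have h1 : HasDerivAt (fun t ↦ G (c t)) (fderiv ℝ G (c s) c') s :=
    HasFDerivAt.comp_hasDerivAt (E := E →L[ℝ] E →L[ℝ] ℝ) s hG.hasFDerivAt hc
  have h2 : HasDerivAt (fun t ↦ G (c t) (V t)) (fderiv ℝ G (c s) c' (V s) + G (c s) V') s :=
    h1.clm_apply hV
  have h3 := h2.clm_apply hW
  rwa [add_apply] at h3

/-- Metric compatibility of the Christoffel symbols. -/
theorem chartChristoffel_compatible [FiniteDimensional ℝ E] {G : E → E →L[ℝ] E →L[ℝ] ℝ} {u : E}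
    (hG : DifferentiableAt ℝ G u) (hs : ∀ u v w, G u v w = G u w v)
    (hnd : ∀ v, (∀ w, G u v w = 0) → v = 0) (a V W V' W' : E) :
    fderiv ℝ G u a V W + G u V' W + G u V W' =
      G u (V' + chartChristoffel G u V a) W + G u V (W' + chartChristoffel G u W a) := by
  have e4 := two_mul_inner_chartChristoffel hnd a V W
  have e5 := two_mul_inner_chartChristoffel hnd a W V
  have e6 := fderiv_form_symm hG hs a V W
  have e7 := fderiv_form_symm hG hs V a W
  have e8 := fderiv_form_symm hG hs W a V
  rw [map_add, map_add, add_apply, hs u V (chartChristoffel G u W a)]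
  linarith

end VectorSpace

variable {M : Type*} [TopologicalSpace M] [ChartedSpace E3 M] [IsManifold (𝓡 3) ∞ M]
  (g : PseudoMetric M)

namespace PseudoMetric

theorem differentiableAt_gram (x : M) :
    DifferentiableAt ℝ (g.gram x) (extChartAt (𝓡 3) x x) :=
  (g.contDiffAt_gram (mem_extChartAt_target x)).differentiableAt (by simp)

theorem gram_nondeg (x : M) (v : E3)
    (h : ∀ w, g.gram x (extChartAt (𝓡 3) x x) v w = 0) : v = 0 :=
  g.nondeg x v fun w ↦ by
    have := g.gram_self x v w
    rw [← this]
    exact h w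

/-- The connection is compatible with the metric along curves. -/
theorem hasDerivAt_inner {υ : ℝ → M} {V W : (s : ℝ) → TangentSpace (𝓡 3) (υ s)} {s : ℝ}
    (hυ : MDifferentiableAt 𝓘(ℝ, ℝ) (𝓡 3) υ s)
    (hV : DifferentiableAt ℝ (fun t ↦ coord (υ s) ⟨υ t, V t⟩) s)
    (hW : DifferentiableAt ℝ (fun t ↦ coord (υ s) ⟨υ t, W t⟩) s) :
    HasDerivAt (fun t ↦ g.val (υ t) (V t) (W t))
      (g.val (υ s) (g.covDerivAlong υ V s) (W s) + g.val (υ s) (V s) (g.covDerivAlong υ W s))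
      s := by
  set x := υ s with hx
  have hsrc : υ s ∈ (chartAt E3 x).source := mem_chart_source E3 x
  have hc := coord_velocity hsrc hυ
  have h1 := hasDerivAt_form (G := g.gram x) (g.differentiableAt_gram x) hc hV.hasDerivAt
    hW.hasDerivAt
  have h2 : (fun t ↦ g.val (υ t) (V t) (W t)) =ᶠ[𝓝 s] fun t ↦
      g.gram x (extChartAt (𝓡 3) x (υ t)) (coord x ⟨υ t, V t⟩) (coord x ⟨υ t, W t⟩) := by
    filter_upwards [eventually_mem_chart hsrc hυ.continuousAt] with t ht
    exact g.inner_eq_gram ht _ _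
  refine (h1.congr_of_eventuallyEq h2).congr_deriv ?_
  have e1 : ∀ v : TangentSpace (𝓡 3) (υ s), coord x ⟨υ s, v⟩ = v := coord_self x
  have e2 := g.gram_self x (g.covDerivAlong υ V s) (W s)
  have e3 := g.gram_self x (V s) (g.covDerivAlong υ W s)
  refine Eq.trans ?_ (congrArg₂ (· + ·) e2 e3)
  simp only [e1]
  exact chartChristoffel_compatible (g.differentiableAt_gram x) (g.gram_symm x) (g.gram_nondeg x)
    (velocity υ s) (V s) (W s) _ _

/-- Along a curve, the covariant derivative of a vector field of the manifold is `∇_{υ'} Y`. -/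
theorem covDerivAlong_comp {υ : ℝ → M} {Y : (x : M) → TangentSpace (𝓡 3) x} {s : ℝ}
    (hυ : MDifferentiableAt 𝓘(ℝ, ℝ) (𝓡 3) υ s)
    (hY : DifferentiableAt ℝ (fun u : E3 ↦ coord (υ s)
      ⟨(extChartAt (𝓡 3) (υ s)).symm u, Y ((extChartAt (𝓡 3) (υ s)).symm u)⟩)
      (extChartAt (𝓡 3) (υ s) (υ s))) :
    g.covDerivAlong υ (fun t ↦ Y (υ t)) s = g.covDeriv Y (υ s) (velocity υ s) := by
  have hsrc : υ s ∈ (chartAt E3 (υ s)).source := mem_chart_source E3 (υ s)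
  have hc := coord_velocity hsrc hυ
  rw [coord_self] at hc
  have h1 := hY.hasFDerivAt.comp_hasDerivAt s hc
  have h2 : (fun t ↦ coord (υ s) ⟨υ t, Y (υ t)⟩) =ᶠ[𝓝 s]
      (fun u : E3 ↦ coord (υ s)
      ⟨(extChartAt (𝓡 3) (υ s)).symm u, Y ((extChartAt (𝓡 3) (υ s)).symm u)⟩) ∘
      fun t ↦ extChartAt (𝓡 3) (υ s) (υ t) := by
    filter_upwards [eventually_mem_chart hsrc hυ.continuousAt] with t ht
    rw [Function.comp_apply, (extChartAt (𝓡 3) (υ s)).left_inv (by simpa using ht)]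
  have h3 := (h1.congr_of_eventuallyEq h2).deriv
  exact congrArg (· + (g.christoffel (υ s) (Y (υ s)) (velocity υ s) : E3)) h3

end PseudoMetric

end Connection

end ContactGeometry

/-! ### The covariant derivative of the characteristic field -/

namespace ContactGeometry

section Characteristic

open Filter Topology Set

section VectorSpace

variable {E : Type*} [NormedAddCommGroup E] [NormedSpace ℝ E]

/-- The Lie derivative of the metric along `Ξ`, in terms of the covariant derivative of `Ξ`. -/
theorem chartChristoffel_lie [FiniteDimensional ℝ E] {G : E → E →L[ℝ] E →L[ℝ] ℝ} {u : E}
    (hG : DifferentiableAt ℝ G u) (hs : ∀ u v w, G u v w = G u w v)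
    (hnd : ∀ v, (∀ w, G u v w = 0) → v = 0) (ξ v w v' w' : E) :
    G u (v' + chartChristoffel G u ξ v) w + G u v (w' + chartChristoffel G u ξ w) =
      fderiv ℝ G u ξ v w + G u v' w + G u v w' := by
  have e4 := two_mul_inner_chartChristoffel hnd v ξ w
  have e5 := two_mul_inner_chartChristoffel hnd w ξ v
  have e6 := fderiv_form_symm hG hs ξ v w
  rw [map_add, map_add, add_apply, hs u v (chartChristoffel G u ξ w)]
  linarith

theorem hasDerivAt_line (u v : E) : HasDerivAt (fun t : ℝ ↦ u + t • v) v 0 := by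
  simpa using ((hasDerivAt_id (0 : ℝ)).smul_const v).const_add u

theorem hasDerivAt_comp_line {F : Type*} [NormedAddCommGroup F] [NormedSpace ℝ F] {f : E → F}
    {u : E} (hf : DifferentiableAt ℝ f u) (v : E) :
    HasDerivAt (fun t : ℝ ↦ f (u + t • v)) (fderiv ℝ f u v) 0 := by
  have h := hasDerivAt_line u v
  have hf' : HasFDerivAt f (fderiv ℝ f u) (u + (0 : ℝ) • v) := by
    simpa using hf.hasFDerivAt
  exact hf'.comp_hasDerivAt 0 h

theorem tendsto_line (u v : E) : Tendsto (fun t : ℝ ↦ u + t • v) (𝓝 0) (𝓝 u) := by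
  simpa using (hasDerivAt_line u v).continuousAt.tendsto

/-- If the Lie derivative of `η` along `ξ` vanishes, and that of `φ` takes values in the kernel
of `φ`, then the Lie derivative of the metric is `φ`-invariant: differentiate the compatibility
of `g` with `φ` and `η`. Here `Φ v`, `H v` are the fields `φ v`, `η v` for constant `v`, and `Ξ'`
is the derivative of the field `ξ`. -/
theorem lie_form_phi_invariant [FiniteDimensional ℝ E] {G : E → E →L[ℝ] E →L[ℝ] ℝ} {u : E}
    (hG : DifferentiableAt ℝ G u) (hs : ∀ u v w, G u v w = G u w v)
    {φ : E →L[ℝ] E} {ξ : E} {η : E →L[ℝ] ℝ} {ε : ℝ} (h : IsContactAlgebra (G u) φ ξ η ε)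
    {Φ : E → E → E} (hΦ : ∀ v, DifferentiableAt ℝ (Φ v) u) (hΦu : ∀ v, Φ v u = φ v)
    {H : E → E → ℝ} (hH : ∀ v, DifferentiableAt ℝ (H v) u) (hHu : ∀ v, H v u = η v)
    (hcomp : ∀ v w, ∀ᶠ x in 𝓝 u, G x (Φ v x) (Φ w x) = G x v w - ε * H v x * H w x)
    (Ξ' : E →L[ℝ] E) (hη : ∀ v, fderiv ℝ (H v) u ξ + η (Ξ' v) = 0)
    (hφ : ∀ v, φ (fderiv ℝ (Φ v) u ξ - Ξ' (φ v) + φ (Ξ' v)) = 0) (v w : E) :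
    G u ((Ξ' + chartChristoffel G u ξ) (φ v)) (φ w)
        + G u (φ v) ((Ξ' + chartChristoffel G u ξ) (φ w)) =
      G u ((Ξ' + chartChristoffel G u ξ) v) w + G u v ((Ξ' + chartChristoffel G u ξ) w) := by
  have hG' : DifferentiableAt ℝ G (u + (0 : ℝ) • ξ) := by simpa using hG
  have h1 := hasDerivAt_form hG' (hasDerivAt_line u ξ) (hasDerivAt_comp_line (hΦ v) ξ)
    (hasDerivAt_comp_line (hΦ w) ξ)
  have h2 := hasDerivAt_form hG' (hasDerivAt_line u ξ) (hasDerivAt_const (0 : ℝ) v)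
    (hasDerivAt_const (0 : ℝ) w)
  have h3 := h2.sub (((hasDerivAt_comp_line (hH v) ξ).const_mul ε).mul
    (hasDerivAt_comp_line (hH w) ξ))
  have h4 := h1.unique (h3.congr_of_eventuallyEq ((tendsto_line u ξ).eventually (hcomp v w)))
  have hker : ∀ v, fderiv ℝ (Φ v) u ξ =
      Ξ' (φ v) - φ (Ξ' v) + η (fderiv ℝ (Φ v) u ξ - Ξ' (φ v) + φ (Ξ' v)) • ξ := fun v ↦ by
    have := h.φ_sq (fderiv ℝ (Φ v) u ξ - Ξ' (φ v) + φ (Ξ' v))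
    rw [hφ v, map_zero, eq_comm, neg_add_eq_zero] at this
    rw [← this]
    abel
  have hξφ : ∀ v, G u ξ (φ v) = 0 := fun v ↦ by
    rw [h.symm, h.inner_xi, h.eta_phi, mul_zero]
  rw [hker v, hker w] at h4
  simp only [zero_smul, add_zero, hΦu, hHu, map_zero, zero_apply, map_add, map_sub, map_smul,
    add_apply, sub_apply, smul_apply, smul_eq_mul, hξφ, h.symm (φ v) ξ, mul_zero,
    h.compatible] at h4
  have e1 := hη v
  have e2 := hη w
  simp only [add_apply]
  rw [chartChristoffel_lie hG hs h.nondeg, chartChristoffel_lie hG hs h.nondeg]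
  linear_combination h4 - ε * η w * e1 - ε * η v * e2

end VectorSpace

variable {M : Type*} [TopologicalSpace M] [ChartedSpace E3 M]

theorem dirDeriv_eq {f : M → ℝ} {x : M} (hf : MDifferentiableAt (𝓡 3) 𝓘(ℝ, ℝ) f x)
    (v : TangentSpace (𝓡 3) x) :
    dirDeriv f x v = fderiv ℝ (fun u ↦ f ((extChartAt (𝓡 3) x).symm u))
      (extChartAt (𝓡 3) x x) v := by
  have h : fderivWithin ℝ (writtenInExtChartAt (𝓡 3) 𝓘(ℝ, ℝ) x f) (range (𝓡 3))
      (extChartAt (𝓡 3) x x) =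
      fderiv ℝ (fun u ↦ f ((extChartAt (𝓡 3) x).symm u)) (extChartAt (𝓡 3) x x) := by
    rw [modelWithCornersSelf_coe, range_id, fderivWithin_univ]
    rfl
  exact (DFunLike.congr_fun hf.mfderiv v).trans (DFunLike.congr_fun h v)

variable [IsManifold (𝓡 3) ∞ M]

/-- A vector field in the coordinates of the chart at `x`. -/
noncomputable def localRep (x : M) (Y : (y : M) → TangentSpace (𝓡 3) y) (u : E3) : E3 :=
  coord x ⟨(extChartAt (𝓡 3) x).symm u, Y ((extChartAt (𝓡 3) x).symm u)⟩

theorem localRep_self (x : M) (Y : (y : M) → TangentSpace (𝓡 3) y) :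
    localRep x Y (extChartAt (𝓡 3) x x) = Y x := by
  rw [localRep, extChartAt_to_inv, coord_self]

theorem contDiffAt_localRep {x : M} {Y : (y : M) → TangentSpace (𝓡 3) y}
    (hY : ContMDiffAt (𝓡 3) (𝓡 3).tangent ∞ (fun y ↦ (⟨y, Y y⟩ : TangentBundle (𝓡 3) M)) x) :
    ContDiffAt ℝ ∞ (localRep x Y) (extChartAt (𝓡 3) x x) := by
  have h1 := contMDiffAt_symm (mem_extChartAt_target (I := 𝓡 3) x)
  rw [← extChartAt_to_inv (I := 𝓡 3) x] at hY
  have h2 := hY.comp _ h1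
  have h3 := (contMDiffAt_iff_coord (f := (extChartAt (𝓡 3) x).symm)
    (V := fun u ↦ Y ((extChartAt (𝓡 3) x).symm u)) (x := x)
    (symm_mem_source (mem_extChartAt_target x))).mp h2
  exact contMDiffAt_iff_contDiffAt.mp h3.2

theorem mpullbackWithin_symm_eq {x : M} {u : E3} (hu : u ∈ (extChartAt (𝓡 3) x).target)
    (Y : (y : M) → TangentSpace (𝓡 3) y) :
    VectorField.mpullbackWithin 𝓘(ℝ, E3) (𝓡 3) (extChartAt (𝓡 3) x).symm Y (range (𝓡 3)) u =
      localRep x Y u := by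
  have : IsManifold (𝓡 3) 1 M := IsManifold.of_le (n := ∞) (by norm_cast)
  rw [VectorField.mpullbackWithin_apply]
  have hinv := isInvertible_mfderivWithin_extChartAt_symm (I := 𝓡 3) hu
  obtain ⟨e, he⟩ := hinv
  rw [← he, ContinuousLinearMap.inverse_equiv]
  have h1 := ofCoord_coord (symm_mem_source hu) (Y ((extChartAt (𝓡 3) x).symm u))
  have h2 : e (localRep x Y u) = Y ((extChartAt (𝓡 3) x).symm u) := by
    rw [ofCoord_eq_mfderiv hu] at h1
    have h3 : mfderivWithin 𝓘(ℝ, E3) (𝓡 3) (extChartAt (𝓡 3) x).symm (range (𝓡 3)) u =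
        mfderiv 𝓘(ℝ, E3) (𝓡 3) (extChartAt (𝓡 3) x).symm u := by
      rw [modelWithCornersSelf_coe, range_id, mfderivWithin_univ]
    rw [h3] at he
    exact (DFunLike.congr_fun he _).trans h1
  exact e.symm_apply_eq.mpr h2.symm

/-- The Lie bracket at `x`, in the chart at `x`, whose differential at `x` is the identity. -/
theorem mlieBracket_eq (x : M) (X Y : (y : M) → TangentSpace (𝓡 3) y) :
    VectorField.mlieBracket (𝓡 3) X Y x =
      (fderiv ℝ (localRep x Y) (extChartAt (𝓡 3) x x) (X x)
        - fderiv ℝ (localRep x X) (extChartAt (𝓡 3) x x) (Y x) : E3) := by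
  have : IsManifold (𝓡 3) 1 M := IsManifold.of_le (n := ∞) (by norm_cast)
  have hid : ∀ w : E3, (mfderiv (𝓡 3) 𝓘(ℝ, E3) (extChartAt (𝓡 3) x) x).inverse w = w := by
    intro w
    obtain ⟨e, he⟩ := isInvertible_mfderiv_extChartAt (I := 𝓡 3) (mem_extChartAt_source x)
    rw [← he, ContinuousLinearMap.inverse_equiv]
    refine e.symm_apply_eq.mpr ?_
    have h1 := DFunLike.congr_fun (mfderiv_extChartAt_self (𝕜 := ℝ) (I := 𝓡 3) (x := x)) w
    exact h1.symm.trans (DFunLike.congr_fun he w).symm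
  rw [← VectorField.mlieBracketWithin_univ, VectorField.mlieBracketWithin_apply]
  refine (hid _).trans ?_
  have hev : ∀ Z : (y : M) → TangentSpace (𝓡 3) y,
      VectorField.mpullbackWithin 𝓘(ℝ, E3) (𝓡 3) (extChartAt (𝓡 3) x).symm Z (range (𝓡 3))
        =ᶠ[𝓝 (extChartAt (𝓡 3) x x)] localRep x Z := fun Z ↦ by
    filter_upwards [extChartAt_target_mem_nhds' (mem_extChartAt_target x)] with u hu
    exact mpullbackWithin_symm_eq hu Z
  have h0 : (extChartAt (𝓡 3) x).symm ⁻¹' univ ∩ range (𝓡 3) = univ := by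
    rw [modelWithCornersSelf_coe, range_id, preimage_univ, inter_univ]
  rw [h0]
  refine (congrFun (VectorField.lieBracketWithin_univ (𝕜 := ℝ) (E := E3)) _).trans ?_
  have h1 := Filter.EventuallyEq.lieBracket_vectorField_eq (𝕜 := ℝ) (E := E3) (hev X) (hev Y)
  refine Eq.trans h1 ?_
  rw [VectorField.lieBracket, localRep_self, localRep_self]

end Characteristic

end ContactGeometry

namespace ContactGeometry

namespace AlmostContactPseudoMetric

open Filter Topology Set

variable {M : Type*} [TopologicalSpace M] [ChartedSpace E3 M] [IsManifold (𝓡 3) ∞ M]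

theorem isContactAlgebra (Q : AlmostContactPseudoMetric M) (x : M) :
    IsContactAlgebra (Q.g.val x) (Q.φ x) (Q.ξ x) (Q.η x) Q.ε where
  symm := Q.g.symm x
  nondeg := Q.g.nondeg x
  ε_sq := Q.ε_sq
  φ_sq := Q.φ_sq x
  η_ξ := Q.η_ξ x
  compatible := Q.compatible x

theorem eta_eq (Q : AlmostContactPseudoMetric M) {x : M} (v : TangentSpace (𝓡 3) x) :
    Q.η x v = Q.ε * Q.g.val x v (Q.ξ x) := by
  have e := Q.ε_sq
  rw [(Q.isContactAlgebra x).inner_xi]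
  linear_combination -Q.η x v * e

/-- The contact structure of `T_x M`, in the coordinates of the chart at `x`. -/
theorem isContactAlgebra_gram (Q : AlmostContactPseudoMetric M) (x : M) :
    IsContactAlgebra (V := E3) (Q.g.gram x (extChartAt (𝓡 3) x x)) (Q.φ x) (Q.ξ x) (Q.η x)
      Q.ε where
  symm := Q.g.gram_symm x _
  nondeg := Q.g.gram_nondeg x
  ε_sq := Q.ε_sq
  φ_sq := Q.φ_sq x
  η_ξ := Q.η_ξ x
  compatible v w := by
    have h1 := Q.g.gram_self x (Q.φ x v) (Q.φ x w)
    have h2 := Q.g.gram_self x v w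
    exact h1.trans ((Q.compatible x v w).trans
      (congrArg (fun r ↦ r - Q.ε * Q.η x v * Q.η x w) h2.symm))

/-- `η` applied to a smooth vector field. -/
theorem contMDiffAt_eta (Q : AlmostContactPseudoMetric M) {x : M}
    {Y : (y : M) → TangentSpace (𝓡 3) y}
    (hY : ContMDiffAt (𝓡 3) (𝓡 3).tangent ∞ (fun y ↦ (⟨y, Y y⟩ : TangentBundle (𝓡 3) M)) x) :
    ContMDiffAt (𝓡 3) 𝓘(ℝ, ℝ) ∞ (fun y ↦ Q.η y (Y y)) x := by
  simp only [Q.eta_eq]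
  exact (contMDiffAt_const (I := 𝓡 3) (I' := 𝓘(ℝ, ℝ)) (c := Q.ε)).smul
    (Q.g.contMDiffAt_inner hY (Q.ξ_smooth x))

theorem contMDiffAt_phi (Q : AlmostContactPseudoMetric M) {x : M}
    {Y : (y : M) → TangentSpace (𝓡 3) y}
    (hY : ContMDiffAt (𝓡 3) (𝓡 3).tangent ∞ (fun y ↦ (⟨y, Y y⟩ : TangentBundle (𝓡 3) M)) x) :
    ContMDiffAt (𝓡 3) (𝓡 3).tangent ∞
      (fun y ↦ (⟨y, Q.φ y (Y y)⟩ : TangentBundle (𝓡 3) M)) x := by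
  have : IsManifold (𝓡 3) 1 M := IsManifold.of_le (n := ∞) (by norm_cast)
  exact ContMDiffAt.clm_bundle_apply (F₁ := E3) (F₂ := E3)
    (E₁ := fun x : M ↦ TangentSpace (𝓡 3) x) (E₂ := fun x : M ↦ TangentSpace (𝓡 3) x)
    (n := ∞) (IB := 𝓡 3) (IM := 𝓡 3) (b := fun y : M ↦ y)
    (ϕ := Q.φ) (v := Y) (x := x) (Q.φ_smooth x) hY

theorem contDiffAt_comp_symm {f : M → ℝ} {x : M} (hf : ContMDiffAt (𝓡 3) 𝓘(ℝ, ℝ) ∞ f x) :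
    ContDiffAt ℝ ∞ (fun u ↦ f ((extChartAt (𝓡 3) x).symm u)) (extChartAt (𝓡 3) x x) := by
  have h1 := contMDiffAt_symm (mem_extChartAt_target (I := 𝓡 3) x)
  rw [← extChartAt_to_inv (I := 𝓡 3) x] at hf
  exact contMDiffAt_iff_contDiffAt.mp (hf.comp _ h1)

theorem localRep_ofCoord (x : M) (v : E3) :
    localRep x (fun y ↦ ofCoord x y v) =ᶠ[𝓝 (extChartAt (𝓡 3) x x)] fun _ ↦ v := by
  filter_upwards [extChartAt_target_mem_nhds' (mem_extChartAt_target x)] with u hu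
  exact coord_ofCoord (symm_mem_source hu) v

/-- Normality, applied to `ξ` and a smooth vector field `X`: the Lie derivative of `η`
along `ξ` vanishes, and that of `φ` takes values in the kernel of `φ`. -/
theorem IsNormal.lie_xi {Q : AlmostContactPseudoMetric M} (hQ : Q.IsNormal) {x : M}
    {X : (y : M) → TangentSpace (𝓡 3) y}
    (hX : ContMDiffAt (𝓡 3) (𝓡 3).tangent ∞ (fun y ↦ (⟨y, X y⟩ : TangentBundle (𝓡 3) M)) x) :
    dirDeriv (fun y ↦ Q.η y (X y)) x (Q.ξ x)
      + Q.η x (VectorField.mlieBracket (𝓡 3) X Q.ξ x) = 0 ∧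
    Q.φ x (-VectorField.mlieBracket (𝓡 3) (fun y ↦ Q.φ y (X y)) Q.ξ x
      + Q.φ x (VectorField.mlieBracket (𝓡 3) X Q.ξ x)) = 0 := by
  have h := hQ x X Q.ξ hX (Q.ξ_smooth x)
  have hφξ : (fun y ↦ Q.φ y (Q.ξ y)) = 0 := funext fun y ↦ (Q.isContactAlgebra y).phi_xi
  have hηξ : (fun y ↦ Q.η y (Q.ξ y)) = fun _ ↦ (1 : ℝ) := funext Q.η_ξ
  have hc : dirDeriv (fun _ : M ↦ (1 : ℝ)) x (X x) = 0 := by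
    rw [dirDeriv, mfderiv_const]
    rfl
  rw [nijenhuis, twoDEta, hφξ, hηξ, hc, VectorField.mlieBracket_zero_right,
    VectorField.mlieBracket_zero_right] at h
  simp only [Pi.zero_apply, map_zero, sub_zero, zero_sub] at h
  have h1 := congrArg (Q.η x) h
  simp only [map_add, map_neg, map_smul, (Q.isContactAlgebra x).eta_phi, Q.η_ξ, map_zero,
    smul_eq_mul, mul_one, neg_zero, zero_add] at h1
  have h2 : dirDeriv (fun y ↦ Q.η y (X y)) x (Q.ξ x)
      + Q.η x (VectorField.mlieBracket (𝓡 3) X Q.ξ x) = 0 := by linarith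
  refine ⟨h2, ?_⟩
  rw [h1, zero_smul, add_zero] at h
  rw [map_add, map_neg]
  exact h

/-- In the chart at `x`, the Lie derivatives of `η` and `φ` along `ξ`, evaluated at fields with
constant coordinates. -/
theorem IsNormal.lie_xi_chart {Q : AlmostContactPseudoMetric M} (hQ : Q.IsNormal) (x : M)
    {φ : E3 →L[ℝ] E3} (hφ : φ = Q.φ x) {ξ : E3} (hξ : ξ = Q.ξ x) {η : E3 →L[ℝ] ℝ}
    (hη : η = Q.η x) (v : E3) :
    fderiv ℝ (fun u ↦ Q.η ((extChartAt (𝓡 3) x).symm u)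
        (ofCoord x ((extChartAt (𝓡 3) x).symm u) v)) (extChartAt (𝓡 3) x x) ξ
      + η (fderiv ℝ (localRep x Q.ξ) (extChartAt (𝓡 3) x x) v) = 0 ∧
    φ (fderiv ℝ (localRep x fun y ↦ Q.φ y (ofCoord x y v)) (extChartAt (𝓡 3) x x) ξ
      - fderiv ℝ (localRep x Q.ξ) (extChartAt (𝓡 3) x x) (φ v)
      + φ (fderiv ℝ (localRep x Q.ξ) (extChartAt (𝓡 3) x x) v)) = 0 := by
  have hX := contMDiffAt_ofCoord x v
  obtain ⟨h1, h2⟩ := hQ.lie_xi hX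
  have hv : ofCoord x x v = v := ofCoord_self x v
  set Ξ' := fderiv ℝ (localRep x Q.ξ) (extChartAt (𝓡 3) x x) with hΞ
  have b1 : VectorField.mlieBracket (𝓡 3) (fun y ↦ ofCoord x y v) Q.ξ x = (Ξ' v : E3) := by
    rw [mlieBracket_eq, (localRep_ofCoord x v).fderiv_eq, fderiv_const_apply]
    exact (sub_zero _).trans (congrArg Ξ' hv)
  have b2 : VectorField.mlieBracket (𝓡 3) (fun y ↦ Q.φ y (ofCoord x y v)) Q.ξ x =
      (Ξ' (φ v) -
        fderiv ℝ (localRep x fun y ↦ Q.φ y (ofCoord x y v)) (extChartAt (𝓡 3) x x) ξ : E3) := by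
    rw [mlieBracket_eq, hφ, hξ]
    exact congrArg (fun w : E3 ↦ (Ξ' (Q.φ x w) -
      fderiv ℝ (localRep x fun y ↦ Q.φ y (ofCoord x y v)) (extChartAt (𝓡 3) x x) (Q.ξ x) : E3)) hv
  have b3 := dirDeriv_eq ((Q.contMDiffAt_eta hX).mdifferentiableAt (by simp)) (Q.ξ x)
  rw [b1, b3] at h1
  rw [b1, b2] at h2
  subst hφ hξ hη
  refine ⟨h1, Eq.trans (congrArg (Q.φ x) ?_) h2⟩
  exact congrArg (· + (Q.φ x (Ξ' v) : E3)) (neg_sub _ _).symm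

/-- For a quasi-Sasakian structure, `∇_X ξ = -ε α φ X`. -/
theorem IsQuasiSasakian.covDeriv_xi {Q : AlmostContactPseudoMetric M} (hQ : Q.IsQuasiSasakian)
    (x : M) (v : TangentSpace (𝓡 3) x) :
    Q.g.covDeriv Q.ξ x v = -(Q.ε * Q.α x) • Q.φ x v := by
  have h := Q.isContactAlgebra_gram x
  have hε := h.ε_ne_zero
  have hξd : DifferentiableAt ℝ (localRep x Q.ξ) (extChartAt (𝓡 3) x x) :=
    (contDiffAt_localRep (Q.ξ_smooth x)).differentiableAt (by simp)
  have htr : LinearMap.trace ℝ (TangentSpace (𝓡 3) x)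
      (Q.g.covDeriv Q.ξ x : TangentSpace (𝓡 3) x →ₗ[ℝ] TangentSpace (𝓡 3) x) = 0 := by
    have := hQ.beta_eq_zero x
    rw [β] at this
    exact (mul_eq_zero.mp this).resolve_left (div_ne_zero hε two_ne_zero)
  have hG := Q.g.differentiableAt_gram x
  have hs := Q.g.gram_symm x
  have hinv := lie_form_phi_invariant hG hs h
    (Φ := fun v ↦ localRep x fun y ↦ Q.φ y (ofCoord x y v))
    (fun v ↦ (contDiffAt_localRep (Q.contMDiffAt_phi (contMDiffAt_ofCoord x v))).differentiableAt
      (by simp))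
    (fun v ↦ (localRep_self x _).trans (congrArg (Q.φ x) (ofCoord_self x v)))
    (H := fun v u ↦ Q.η ((extChartAt (𝓡 3) x).symm u) (ofCoord x ((extChartAt (𝓡 3) x).symm u) v))
    (fun v ↦ (contDiffAt_comp_symm (Q.contMDiffAt_eta (contMDiffAt_ofCoord x v))).differentiableAt
      (by simp))
    (fun v ↦ by
      rw [extChartAt_to_inv]
      exact congrArg (Q.η x) (ofCoord_self x v))
    (fun v w ↦ by
      filter_upwards [extChartAt_target_mem_nhds' (mem_extChartAt_target x)] with u hu
      rw [Q.g.gram_apply, Q.g.gram_apply, localRep, localRep, ofCoord_coord (symm_mem_source hu),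
        ofCoord_coord (symm_mem_source hu), Q.compatible])
    (fderiv ℝ (localRep x Q.ξ) (extChartAt (𝓡 3) x x))
    (fun v ↦ (hQ.normal.lie_xi_chart x rfl rfl rfl v).1)
    (fun v ↦ (hQ.normal.lie_xi_chart x rfl rfl rfl v).2)
  have hξ : ∀ w : E3, Q.g.gram x (extChartAt (𝓡 3) x x) (Q.g.covDeriv Q.ξ x w) (Q.ξ x) = 0 := by
    intro w
    have hline := tendsto_line (extChartAt (𝓡 3) x x) w
    have hξd' := hasDerivAt_comp_line hξd w
    have h1 := hasDerivAt_form (G := Q.g.gram x) (by simpa using hG)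
      (hasDerivAt_line (extChartAt (𝓡 3) x x) w) hξd' hξd'
    have h2 : ∀ᶠ t : ℝ in 𝓝 0, Q.g.gram x (extChartAt (𝓡 3) x x + t • w)
        (localRep x Q.ξ (extChartAt (𝓡 3) x x + t • w))
        (localRep x Q.ξ (extChartAt (𝓡 3) x x + t • w)) = Q.ε := by
      filter_upwards [hline.eventually
        (extChartAt_target_mem_nhds' (mem_extChartAt_target x))] with t ht
      rw [Q.g.gram_apply, localRep, ofCoord_coord (symm_mem_source ht),
        (Q.isContactAlgebra _).inner_xi_xi]
    have h3 := h1.unique ((hasDerivAt_const (0 : ℝ) Q.ε).congr_of_eventuallyEq h2)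
    rw [zero_smul, add_zero, localRep_self] at h3
    have h4 : Q.g.gram x (extChartAt (𝓡 3) x x) (Q.g.covDeriv Q.ξ x w) (Q.ξ x)
        + Q.g.gram x (extChartAt (𝓡 3) x x) (Q.ξ x) (Q.g.covDeriv Q.ξ x w) = 0 :=
      (chartChristoffel_compatible hG hs (Q.g.gram_nondeg x) w (Q.ξ x) (Q.ξ x) _ _).symm.trans h3
    have h5 : Q.g.gram x (extChartAt (𝓡 3) x x) (Q.ξ x) (Q.g.covDeriv Q.ξ x w) =
      Q.g.gram x (extChartAt (𝓡 3) x x) (Q.g.covDeriv Q.ξ x w) (Q.ξ x) := hs _ _ _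
    linarith
  exact h.eq_smul_phi (by simp) (Q.g.covDeriv Q.ξ x) hinv hξ htr v

end AlmostContactPseudoMetric

end ContactGeometry

/-! ### The acceleration of a curve in an arbitrary chart -/

namespace ContactGeometry

section Acceleration

open Filter Topology Set

section VectorSpace

variable {E : Type*} [NormedAddCommGroup E] [NormedSpace ℝ E]

theorem contDiffAt_deriv {f : ℝ → E} {t : ℝ} (hf : ContDiffAt ℝ ∞ f t) :
    ContDiffAt ℝ ∞ (deriv f) t := by
  have h : deriv f = fun r ↦ fderiv ℝ f r 1 := funext fun r ↦ (fderiv_apply_one_eq_deriv).symm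
  rw [h]
  exact (hf.fderiv_right (m := ∞) (by norm_cast)).clm_apply contDiffAt_const

/-- The Euler–Lagrange expression of the energy of `G`, at a point `u` of a curve with first and
second derivatives `v`, `a`: it equals `2 G(a + Γ(v, v), z)`, but no inverse of `G` occurs in
it. -/
noncomputable def lagrangeForm (G : E → E →L[ℝ] E →L[ℝ] ℝ) (u v a z : E) : ℝ :=
  2 * (fderiv ℝ G u v v z + G u a z) - fderiv ℝ G u z v v

theorem two_mul_inner_acceleration [FiniteDimensional ℝ E] {G : E → E →L[ℝ] E →L[ℝ] ℝ} {u : E}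
    (hnd : ∀ v, (∀ w, G u v w = 0) → v = 0) (v a z : E) :
    2 * G u (a + chartChristoffel G u v v) z = lagrangeForm G u v a z := by
  rw [map_add, add_apply, mul_add, two_mul_inner_chartChristoffel hnd, lagrangeForm]
  ring

/-- The derivative of the pullback `G` of a form `G'` by a map `ψ`. -/
theorem fderiv_pullback {G G' : E → E →L[ℝ] E →L[ℝ] ℝ} {ψ : E → E} {u : E}
    (hG : DifferentiableAt ℝ G u) (hG' : DifferentiableAt ℝ G' (ψ u)) (hψ : ContDiffAt ℝ 2 ψ u)
    (hpull : ∀ᶠ x in 𝓝 u, ∀ v w, G x v w = G' (ψ x) (fderiv ℝ ψ x v) (fderiv ℝ ψ x w))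
    (b v w : E) :
    fderiv ℝ G u b v w =
      fderiv ℝ G' (ψ u) (fderiv ℝ ψ u b) (fderiv ℝ ψ u v) (fderiv ℝ ψ u w)
        + G' (ψ u) (fderiv ℝ (fderiv ℝ ψ) u b v) (fderiv ℝ ψ u w)
        + G' (ψ u) (fderiv ℝ ψ u v) (fderiv ℝ (fderiv ℝ ψ) u b w) := by
  have hψ1 : DifferentiableAt ℝ ψ u := hψ.differentiableAt (by simp)
  have hψ2 : DifferentiableAt ℝ (fderiv ℝ ψ) u :=
    (hψ.fderiv_right (m := 1) (by norm_num)).differentiableAt (by simp)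
  have hD := hasDerivAt_comp_line hψ2 b
  have hv : ∀ v, HasDerivAt (fun t : ℝ ↦ fderiv ℝ ψ (u + t • b) v)
      (fderiv ℝ (fderiv ℝ ψ) u b v) 0 := fun v ↦ by
    simpa using hD.clm_apply (hasDerivAt_const (0 : ℝ) v)
  have h1 := hasDerivAt_form (G := G') (by simpa using hG') (hasDerivAt_comp_line hψ1 b)
    (hv v) (hv w)
  have h2 := hasDerivAt_form (G := G) (by simpa using hG) (hasDerivAt_line u b)
    (hasDerivAt_const (0 : ℝ) v) (hasDerivAt_const (0 : ℝ) w)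
  have h3 := h2.unique (h1.congr_of_eventuallyEq
    (((tendsto_line u b).eventually hpull).mono fun t ht ↦ ht v w))
  simpa using h3

/-- The Euler–Lagrange expression is invariant under changes of coordinates: the terms with
second derivatives of `ψ` cancel because these are symmetric. -/
theorem lagrangeForm_pullback {G G' : E → E →L[ℝ] E →L[ℝ] ℝ} {ψ : E → E} {u : E}
    (hG : DifferentiableAt ℝ G u) (hG' : DifferentiableAt ℝ G' (ψ u)) (hψ : ContDiffAt ℝ 2 ψ u)
    (hpull : ∀ᶠ x in 𝓝 u, ∀ v w, G x v w = G' (ψ x) (fderiv ℝ ψ x v) (fderiv ℝ ψ x w))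
    (hs : ∀ v w, G' (ψ u) v w = G' (ψ u) w v) (v a z : E) :
    lagrangeForm G u v a z =
      lagrangeForm G' (ψ u) (fderiv ℝ ψ u v) (fderiv ℝ (fderiv ℝ ψ) u v v + fderiv ℝ ψ u a)
        (fderiv ℝ ψ u z) := by
  have hsym : fderiv ℝ (fderiv ℝ ψ) u z v = fderiv ℝ (fderiv ℝ ψ) u v z :=
    hψ.isSymmSndFDerivAt (by simp) z v
  rw [lagrangeForm, lagrangeForm, fderiv_pullback hG hG' hψ hpull,
    fderiv_pullback hG hG' hψ hpull, hpull.self_of_nhds a z, hsym, map_add, add_apply,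
    hs (fderiv ℝ (fderiv ℝ ψ) u v z)]
  ring

end VectorSpace

variable {M : Type*} [TopologicalSpace M] [ChartedSpace E3 M] [IsManifold (𝓡 3) ∞ M]

/-- The change of coordinates from the chart at `x` to the chart at `x'`. -/
noncomputable def transition (x x' : M) (u : E3) : E3 :=
  extChartAt (𝓡 3) x' ((extChartAt (𝓡 3) x).symm u)

theorem eventually_transition {x x' : M} (hx : x ∈ (chartAt E3 x').source) :
    ∀ᶠ u in 𝓝 (extChartAt (𝓡 3) x x), u ∈ (extChartAt (𝓡 3) x).target ∧
      (extChartAt (𝓡 3) x).symm u ∈ (chartAt E3 x').source := by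
  refine Eventually.and (extChartAt_target_mem_nhds' (mem_extChartAt_target x)) ?_
  have h := (contMDiffAt_symm (mem_extChartAt_target (I := 𝓡 3) x)).continuousAt
  refine h.preimage_mem_nhds ((chartAt E3 x').open_source.mem_nhds ?_)
  rwa [extChartAt_to_inv]

theorem contDiffAt_transition {x x' : M} {u : E3} (hu : u ∈ (extChartAt (𝓡 3) x).target)
    (hx : (extChartAt (𝓡 3) x).symm u ∈ (chartAt E3 x').source) :
    ContDiffAt ℝ ∞ (transition x x') u :=
  contMDiffAt_iff_contDiffAt.mp
    ((contMDiffAt_extChartAt' (n := ∞) hx).comp u (contMDiffAt_symm hu))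

theorem coord_ofCoord_eq_fderiv {x x' : M} {u : E3} (hu : u ∈ (extChartAt (𝓡 3) x).target)
    (hx : (extChartAt (𝓡 3) x).symm u ∈ (chartAt E3 x').source) (v : E3) :
    coord x' ⟨(extChartAt (𝓡 3) x).symm u, ofCoord x ((extChartAt (𝓡 3) x).symm u) v⟩ =
      fderiv ℝ (transition x x') u v := by
  have : IsManifold (𝓡 3) 1 M := IsManifold.of_le (n := ∞) (by norm_cast)
  rw [coord_eq_mfderiv hx, ofCoord_eq_mfderiv hu]
  have h1 : HasMFDerivAt 𝓘(ℝ, E3) 𝓘(ℝ, E3) (extChartAt (𝓡 3) x' ∘ (extChartAt (𝓡 3) x).symm) u _ :=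
    (mdifferentiableAt_extChartAt hx).hasMFDerivAt.comp u
      ((contMDiffAt_symm hu).mdifferentiableAt (by simp)).hasMFDerivAt
  have h2 : HasFDerivAt (𝕜 := ℝ) (E := E3) (F := E3) (transition x x') _ u := h1.hasFDerivAt
  rw [h2.fderiv]
  rfl

namespace PseudoMetric

variable (g : PseudoMetric M)

theorem gram_pullback {x x' : M} (hx : x ∈ (chartAt E3 x').source) :
    ∀ᶠ u in 𝓝 (extChartAt (𝓡 3) x x), ∀ v w, g.gram x u v w =
      g.gram x' (transition x x' u) (fderiv ℝ (transition x x') u v)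
        (fderiv ℝ (transition x x') u w) := by
  filter_upwards [eventually_transition hx] with u hu v w
  rw [g.gram_apply, g.inner_eq_gram hu.2, coord_ofCoord_eq_fderiv hu.1 hu.2,
    coord_ofCoord_eq_fderiv hu.1 hu.2]
  rfl

theorem contDiffAt_chart_comp {υ : ℝ → M} {t : ℝ} {x : M} (hx : υ t ∈ (chartAt E3 x).source)
    (hυ : ContMDiffAt 𝓘(ℝ, ℝ) (𝓡 3) ∞ υ t) :
    ContDiffAt ℝ ∞ (fun r ↦ extChartAt (𝓡 3) x (υ r)) t :=
  contMDiffAt_iff_contDiffAt.mp ((contMDiffAt_extChartAt' (n := ∞) hx).comp t hυ)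

/-- The acceleration `∇_{υ'} υ'`, defined in the chart at `υ(t)`, can be computed in any chart. -/
theorem two_mul_inner_covDerivAlong_velocity {υ : ℝ → M} {t : ℝ} {x' : M}
    (hx : υ t ∈ (chartAt E3 x').source)
    (hυ : ∀ᶠ r in 𝓝 t, ContMDiffAt 𝓘(ℝ, ℝ) (𝓡 3) ∞ υ r) (V : TangentSpace (𝓡 3) (υ t)) :
    2 * g.val (υ t) (g.covDerivAlong υ (velocity υ) t) V =
      lagrangeForm (g.gram x') (extChartAt (𝓡 3) x' (υ t))
        (deriv (fun r ↦ extChartAt (𝓡 3) x' (υ r)) t)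
        (deriv (deriv fun r ↦ extChartAt (𝓡 3) x' (υ r)) t) (coord x' ⟨υ t, V⟩) := by
  have hυt := hυ.self_of_nhds
  have hsrc : υ t ∈ (chartAt E3 (υ t)).source := mem_chart_source E3 _
  set c := fun r ↦ extChartAt (𝓡 3) (υ t) (υ r) with hc
  set ψ := transition (υ t) x' with hψ
  have hcd : ContDiffAt ℝ ∞ c t := contDiffAt_chart_comp hsrc hυt
  have hev := eventually_transition hx
  have hcev : ∀ᶠ r in 𝓝 t, c r ∈ (extChartAt (𝓡 3) (υ t)).target ∧
      (extChartAt (𝓡 3) (υ t)).symm (c r) ∈ (chartAt E3 x').source :=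
    hcd.continuousAt.eventually hev
  have hψt : ContDiffAt ℝ ∞ ψ (c t) :=
    contDiffAt_transition hcev.self_of_nhds.1 hcev.self_of_nhds.2
  have hsrcev := eventually_mem_chart hsrc hυt.continuousAt
  -- velocity and acceleration in the two charts
  have hcc : (fun r ↦ extChartAt (𝓡 3) x' (υ r)) =ᶠ[𝓝 t] fun r ↦ ψ (c r) := by
    filter_upwards [hsrcev] with r hr
    rw [hψ, transition, hc, (extChartAt (𝓡 3) (υ t)).left_inv (by simpa using hr)]
  have hd : deriv (fun r ↦ extChartAt (𝓡 3) x' (υ r)) =ᶠ[𝓝 t]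
      fun r ↦ fderiv ℝ ψ (c r) (deriv c r) := by
    filter_upwards [hcc.eventuallyEq_nhds, hcev, hυ, hsrcev] with r h1 h2 h3 h4
    rw [h1.deriv_eq]
    have h5 := ((contDiffAt_transition h2.1 h2.2).differentiableAt (by simp)).hasFDerivAt
    exact (h5.comp_hasDerivAt r
      ((contDiffAt_chart_comp h4 h3).differentiableAt (by simp)).hasDerivAt).deriv
  have hc1 : HasDerivAt c (deriv c t) t := (hcd.differentiableAt (by simp)).hasDerivAt
  have hc2 : HasDerivAt (deriv c) (deriv (deriv c) t) t :=
    ((contDiffAt_deriv hcd).differentiableAt (by simp)).hasDerivAt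
  have hψ2 : DifferentiableAt ℝ (fderiv ℝ ψ) (c t) :=
    (hψt.fderiv_right (m := 1) (by norm_cast)).differentiableAt (by simp)
  have hdd : deriv (deriv fun r ↦ extChartAt (𝓡 3) x' (υ r)) t =
      fderiv ℝ (fderiv ℝ ψ) (c t) (deriv c t) (deriv c t)
        + fderiv ℝ ψ (c t) (deriv (deriv c) t) := by
    rw [hd.deriv_eq]
    exact ((hψ2.hasFDerivAt.comp_hasDerivAt t hc1).clm_apply hc2).deriv
  -- the acceleration in the chart at `υ(t)`
  have hvel : (fun r ↦ coord (υ t) ⟨υ r, velocity υ r⟩) =ᶠ[𝓝 t] deriv c := by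
    filter_upwards [hυ, hsrcev] with r h3 h4
    exact (coord_velocity h4 (h3.mdifferentiableAt (by simp))).deriv.symm
  have hv0 : deriv c t = velocity υ t := hvel.self_of_nhds.symm.trans (coord_self _ _)
  have hacc : g.covDerivAlong υ (velocity υ) t =
      (deriv (deriv c) t + chartChristoffel (g.gram (υ t)) (c t) (deriv c t) (deriv c t) : E3) := by
    rw [hv0, ← hvel.deriv_eq]
    rfl
  have hinv : (extChartAt (𝓡 3) (υ t)).symm (c t) = υ t := extChartAt_to_inv (υ t)
  have hbase : ψ (c t) = extChartAt (𝓡 3) x' (υ t) := by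
    rw [hψ, transition, hinv]
  have hG' : DifferentiableAt ℝ (g.gram x') (ψ (c t)) := by
    rw [hbase]
    exact (g.contDiffAt_gram ((extChartAt (𝓡 3) x').map_source
      (by simpa using hx))).differentiableAt (by simp)
  have hV : coord x' ⟨υ t, V⟩ = fderiv ℝ ψ (c t) V := by
    have key := coord_ofCoord_eq_fderiv hcev.self_of_nhds.1 hcev.self_of_nhds.2 V
    rw [hinv] at key
    exact (congrArg (fun w ↦ coord x' ⟨υ t, w⟩) (ofCoord_self (υ t) V).symm).trans key
  have h1 := two_mul_inner_acceleration (g.gram_nondeg (υ t)) (deriv c t) (deriv (deriv c) t) V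
  have h2 := lagrangeForm_pullback (g.differentiableAt_gram (υ t)) hG'
    (hψt.of_le (by norm_cast)) (g.gram_pullback hx) (g.gram_symm x' _) (deriv c t)
    (deriv (deriv c) t) V
  rw [hd.self_of_nhds, hdd, hV, ← hbase]
  refine Eq.trans ?_ (h1.trans h2)
  rw [← g.gram_self (υ t), hacc]

end PseudoMetric

end Acceleration

end ContactGeometry

/-! ### The structure equations along the curve -/

namespace ContactGeometry

open Filter Topology Set

section RealAnalysis

theorem hasDerivAt_mul_of_eq_zero {f g : ℝ → ℝ} {g' t : ℝ} (hf : ContinuousAt f t)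
    (hg : HasDerivAt g g' t) (h0 : g t = 0) : HasDerivAt (fun r ↦ f r * g r) (f t * g') t := by
  rw [hasDerivAt_iff_tendsto_slope] at hg ⊢
  refine ((hf.tendsto.mono_left nhdsWithin_le_nhds).mul hg).congr fun r ↦ ?_
  rw [slope_def_field, slope_def_field, h0]
  ring

/-- In the system `m' = κ n`, `n' = -κ m + c`, where `c` is one of `0` and `2 ε τ b` as long as
`1 - ε m ^ 2` does not vanish, the zeros of `(m, n, n')` are interior zeros of `(m, n)`: near
such a zero continuity selects `c = 0`, and then `m ^ 2 + n ^ 2` is constant. -/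
theorem eventually_eq_zero_of_frenet {I : Set ℝ} (hI : IsOpen I) {m n n' b κ τ : ℝ → ℝ} {ε : ℝ}
    (hε : ε ^ 2 = 1) (hm : ∀ t ∈ I, HasDerivAt m (κ t * n t) t)
    (hn : ∀ t ∈ I, HasDerivAt n (n' t) t) (hn' : ContinuousOn n' I) (hκ : ContinuousOn κ I)
    (hb : ContinuousOn b I) (hτ : ContinuousOn τ I) (hτ0 : ∀ t ∈ I, 0 < τ t)
    (hunit : ∀ t ∈ I, ε * m t ^ 2 + ε * n t ^ 2 + b t ^ 2 = 1)
    (hdich : ∀ t ∈ I, 1 - ε * m t ^ 2 ≠ 0 →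
      (n' t + κ t * m t - ε * τ t * b t) ^ 2 = τ t ^ 2 * b t ^ 2)
    {t : ℝ} (ht : t ∈ I) (hm0 : m t = 0) (hn0 : n t = 0) (hn1 : n' t = 0) :
    ∀ᶠ r in 𝓝 t, m r = 0 ∧ n r = 0 := by
  have hIt : I ∈ 𝓝 t := hI.mem_nhds ht
  have cm : ContinuousAt m t := (hm t ht).continuousAt
  have cn' := hn'.continuousAt hIt
  have cκ := hκ.continuousAt hIt
  have cb := hb.continuousAt hIt
  have cτ := hτ.continuousAt hIt
  have hbt : b t ^ 2 = 1 := by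
    have := hunit t ht
    rw [hm0, hn0] at this
    linarith
  have e1 : ∀ᶠ r in 𝓝 t, 1 - ε * m r ^ 2 ≠ 0 := by
    have hc : ContinuousAt (fun r ↦ 1 - ε * m r ^ 2) t := by fun_prop
    exact hc.eventually_ne (by simp [hm0])
  have e2 : ∀ᶠ r in 𝓝 t, n' r + κ r * m r - 2 * ε * τ r * b r ≠ 0 := by
    have hc : ContinuousAt (fun r ↦ n' r + κ r * m r - 2 * ε * τ r * b r) t := by fun_prop
    refine hc.eventually_ne ?_
    have h1 := (hτ0 t ht).ne'
    have h2 : b t ≠ 0 := fun h ↦ by simp [h] at hbt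
    have h3 : ε ≠ 0 := fun h ↦ by simp [h] at hε
    simp [hm0, hn1, h1, h2, h3]
  have e3 : ∀ᶠ r in 𝓝 t, r ∈ I ∧ n' r = -(κ r * m r) := by
    filter_upwards [e1, e2, hIt] with r h1 h2 hr
    have h3 := hdich r hr h1
    have h4 : (n' r + κ r * m r) * (n' r + κ r * m r - 2 * ε * τ r * b r) = 0 := by
      linear_combination h3 - τ r ^ 2 * b r ^ 2 * hε
    exact ⟨hr, by linarith [(mul_eq_zero.mp h4).resolve_right h2]⟩
  obtain ⟨δ, hδ, hball⟩ := Metric.eventually_nhds_iff_ball.mp e3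
  have hderiv : ∀ r ∈ Metric.ball t δ, HasDerivAt (fun r ↦ m r ^ 2 + n r ^ 2) 0 r := fun r hr ↦ by
    obtain ⟨hrI, h2⟩ := hball r hr
    refine (((hm r hrI).pow 2).add ((hn r hrI).pow 2)).congr_deriv ?_
    rw [h2]
    ring
  filter_upwards [Metric.ball_mem_nhds t hδ] with r hr
  have hconst := Metric.isOpen_ball.is_const_of_deriv_eq_zero
    (convex_ball t δ).isPreconnected
    (fun r hr ↦ (hderiv r hr).differentiableAt.differentiableWithinAt)
    (fun r hr ↦ (hderiv r hr).deriv) hr (Metric.mem_ball_self hδ)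
  simp only [hm0, hn0] at hconst
  constructor <;> nlinarith [sq_nonneg (m r), sq_nonneg (n r)]

/-- The zeros of `(m, n, n')` form a closed subset of `I`, which is open by
`eventually_eq_zero_of_frenet`; as `I` is connected, one zero suffices. -/
theorem eq_zero_of_frenet {I : Set ℝ} (hI : IsOpen I) (hI' : I.OrdConnected)
    {m n n' b κ τ : ℝ → ℝ} {ε : ℝ}
    (hε : ε ^ 2 = 1) (hm : ∀ t ∈ I, HasDerivAt m (κ t * n t) t)
    (hn : ∀ t ∈ I, HasDerivAt n (n' t) t) (hn' : ContinuousOn n' I) (hκ : ContinuousOn κ I)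
    (hb : ContinuousOn b I) (hτ : ContinuousOn τ I) (hτ0 : ∀ t ∈ I, 0 < τ t)
    (hunit : ∀ t ∈ I, ε * m t ^ 2 + ε * n t ^ 2 + b t ^ 2 = 1)
    (hdich : ∀ t ∈ I, 1 - ε * m t ^ 2 ≠ 0 →
      (n' t + κ t * m t - ε * τ t * b t) ^ 2 = τ t ^ 2 * b t ^ 2)
    {s : ℝ} (hs : s ∈ I) (hm0 : m s = 0) (hn0 : n s = 0) (hn1 : n' s = 0) :
    ∀ t ∈ I, m t = 0 := by
  have key := fun t ht ↦ eventually_eq_zero_of_frenet hI hε hm hn hn' hκ hb hτ hτ0 hunit hdich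
    (t := t) ht
  let U : Set ℝ := {t | ∀ᶠ r in 𝓝 t, m r = 0 ∧ n r = 0}
  have hU : IsOpen U := isOpen_iff_mem_nhds.mpr fun t ht ↦ eventually_eventually_nhds.mpr ht
  have hz : ∀ r ∈ U ∩ I, m r = 0 ∧ n r = 0 ∧ n' r = 0 := fun r hr ↦ by
    have h1 : ∀ᶠ q in 𝓝 r, m q = 0 ∧ n q = 0 := hr.1
    refine ⟨h1.self_of_nhds.1, h1.self_of_nhds.2, ?_⟩
    exact (hn r hr.2).unique
      ((hasDerivAt_const r (0 : ℝ)).congr_of_eventuallyEq (h1.mono fun q hq ↦ hq.2))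
  have hsub : I ⊆ U := by
    refine (hI'.isPreconnected).subset_of_closure_inter_subset hU
      ⟨s, hs, key s hs hm0 hn0 hn1⟩ ?_
    rintro t ⟨htc, ht⟩
    have hIt : I ∈ 𝓝 t := hI.mem_nhds ht
    have hcl : t ∈ closure (U ∩ I) := by
      rw [inter_comm]
      exact hI.inter_closure ⟨ht, htc⟩
    have hzero : ∀ f : ℝ → ℝ, ContinuousAt f t → (∀ r ∈ U ∩ I, f r = 0) → f t = 0 :=
      fun f hf h0 ↦ by
        have := hf.continuousWithinAt.mem_closure (t := ({0} : Set ℝ)) hcl h0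
        simpa using this
    exact key t ht (hzero m (hm t ht).continuousAt fun r hr ↦ (hz r hr).1)
      (hzero n (hn t ht).continuousAt fun r hr ↦ (hz r hr).2.1)
      (hzero n' (hn'.continuousAt hIt) fun r hr ↦ (hz r hr).2.2)
  exact fun t ht ↦ ((hsub ht : ∀ᶠ r in 𝓝 t, m r = 0 ∧ n r = 0).self_of_nhds).1

set_option synthInstance.maxHeartbeats 200000 in
theorem continuousAt_lagrangeForm {E : Type*} [NormedAddCommGroup E] [NormedSpace ℝ E]
    {G : E → E →L[ℝ] E →L[ℝ] ℝ} {c v a z : ℝ → E} {t : ℝ} (hG : ContDiffAt ℝ ∞ G (c t))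
    (hc : ContinuousAt c t) (hv : ContinuousAt v t) (ha : ContinuousAt a t)
    (hz : ContinuousAt z t) :
    ContinuousAt (fun r ↦ lagrangeForm G (c r) (v r) (a r) (z r)) t := by
  have cG : ContinuousAt (fun r ↦ G (c r)) t := hG.continuousAt.comp hc
  have cD := ContinuousAt.comp (hG.fderiv_right (m := 0) (by norm_cast)).continuousAt hc
  exact (continuousAt_const.mul ((((cD.clm_apply hv).clm_apply hv).clm_apply hz).add
    ((cG.clm_apply ha).clm_apply hz))).sub (((cD.clm_apply hz).clm_apply hv).clm_apply hv)

end RealAnalysis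

variable {M : Type*} [TopologicalSpace M] [ChartedSpace E3 M] [IsManifold (𝓡 3) ∞ M]

theorem contDiffAt_coord {υ : ℝ → M} {V : (s : ℝ) → TangentSpace (𝓡 3) (υ s)} {t : ℝ} {x : M}
    (hx : υ t ∈ (chartAt E3 x).source)
    (hV : ContMDiffAt 𝓘(ℝ, ℝ) (𝓡 3).tangent ∞ (fun s ↦ (⟨υ s, V s⟩ : TangentBundle (𝓡 3) M)) t) :
    ContDiffAt ℝ ∞ (fun s ↦ coord x ⟨υ s, V s⟩) t :=
  contMDiffAt_iff_contDiffAt.mp ((contMDiffAt_iff_coord hx).mp hV).2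

theorem contMDiffAt_velocity {υ : ℝ → M} {t : ℝ}
    (hυ : ∀ᶠ r in 𝓝 t, ContMDiffAt 𝓘(ℝ, ℝ) (𝓡 3) ∞ υ r) :
    ContMDiffAt 𝓘(ℝ, ℝ) (𝓡 3).tangent ∞
      (fun s ↦ (⟨υ s, velocity υ s⟩ : TangentBundle (𝓡 3) M)) t := by
  have hsrc := mem_chart_source E3 (υ t)
  rw [contMDiffAt_iff_coord hsrc]
  refine ⟨hυ.self_of_nhds, contMDiffAt_iff_contDiffAt.mpr ?_⟩
  have h := contDiffAt_deriv (PseudoMetric.contDiffAt_chart_comp hsrc hυ.self_of_nhds)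
  refine h.congr_of_eventuallyEq ?_
  filter_upwards [hυ, eventually_mem_chart hsrc hυ.self_of_nhds.continuousAt] with r h1 h2
  exact (coord_velocity h2 (h1.mdifferentiableAt (by simp))).deriv.symm

/-- The inner product of the acceleration with a smooth field along the curve is continuous. -/
theorem PseudoMetric.continuousAt_inner_acceleration (g : PseudoMetric M) {υ : ℝ → M}
    {V : (s : ℝ) → TangentSpace (𝓡 3) (υ s)} {t : ℝ}
    (hυ : ∀ᶠ r in 𝓝 t, ContMDiffAt 𝓘(ℝ, ℝ) (𝓡 3) ∞ υ r)
    (hV : ContMDiffAt 𝓘(ℝ, ℝ) (𝓡 3).tangent ∞ (fun s ↦ (⟨υ s, V s⟩ : TangentBundle (𝓡 3) M)) t) :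
    ContinuousAt (fun r ↦ g.val (υ r) (g.covDerivAlong υ (velocity υ) r) (V r)) t := by
  have hsrc := mem_chart_source E3 (υ t)
  set c := fun r ↦ extChartAt (𝓡 3) (υ t) (υ r) with hc
  have hcd : ContDiffAt ℝ ∞ c t := contDiffAt_chart_comp hsrc hυ.self_of_nhds
  have hG : ContDiffAt ℝ ∞ (g.gram (υ t)) (c t) :=
    g.contDiffAt_gram (mem_extChartAt_target (υ t))
  have c0 := hcd.continuousAt
  have c1 := (contDiffAt_deriv hcd).continuousAt
  have c2 := (contDiffAt_deriv (contDiffAt_deriv hcd)).continuousAt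
  have cV := (contDiffAt_coord hsrc hV).continuousAt
  have h := (continuousAt_lagrangeForm hG c0 c1 c2 cV).const_mul 2⁻¹
  refine h.congr ?_
  filter_upwards [hυ.eventually_nhds, eventually_mem_chart hsrc hυ.self_of_nhds.continuousAt]
    with r h1 h2
  rw [← g.two_mul_inner_covDerivAlong_velocity h2 h1]
  ring

namespace AlmostContactPseudoMetric

/-- The characteristic field along a curve. -/
theorem contMDiffAt_xi_comp (Q : AlmostContactPseudoMetric M) {υ : ℝ → M} {t : ℝ}
    (hυ : ContMDiffAt 𝓘(ℝ, ℝ) (𝓡 3) ∞ υ t) :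
    ContMDiffAt 𝓘(ℝ, ℝ) (𝓡 3).tangent ∞
      (fun s ↦ (⟨υ s, Q.ξ (υ s)⟩ : TangentBundle (𝓡 3) M)) t :=
  (Q.ξ_smooth (υ t)).comp t hυ

theorem contDiffAt_eta_comp (Q : AlmostContactPseudoMetric M) {υ : ℝ → M}
    {V : (s : ℝ) → TangentSpace (𝓡 3) (υ s)} {t : ℝ}
    (hυ : ContMDiffAt 𝓘(ℝ, ℝ) (𝓡 3) ∞ υ t)
    (hV : ContMDiffAt 𝓘(ℝ, ℝ) (𝓡 3).tangent ∞ (fun s ↦ (⟨υ s, V s⟩ : TangentBundle (𝓡 3) M)) t) :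
    ContDiffAt ℝ ∞ (fun s ↦ Q.η (υ s) (V s)) t := by
  simp only [Q.eta_eq]
  exact contDiffAt_const.mul
    (contMDiffAt_iff_contDiffAt.mp (Q.g.contMDiffAt_inner hV (Q.contMDiffAt_xi_comp hυ)))

/-- The derivative of `η(V)` along a curve in a quasi-Sasakian manifold. -/
theorem IsQuasiSasakian.hasDerivAt_eta {Q : AlmostContactPseudoMetric M} (hQ : Q.IsQuasiSasakian)
    {υ : ℝ → M} {V : (s : ℝ) → TangentSpace (𝓡 3) (υ s)} {t : ℝ}
    (hυ : ContMDiffAt 𝓘(ℝ, ℝ) (𝓡 3) ∞ υ t)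
    (hV : ContMDiffAt 𝓘(ℝ, ℝ) (𝓡 3).tangent ∞ (fun s ↦ (⟨υ s, V s⟩ : TangentBundle (𝓡 3) M)) t) :
    HasDerivAt (fun s ↦ Q.η (υ s) (V s))
      (Q.η (υ t) (Q.g.covDerivAlong υ V t)
        - Q.α (υ t) * Q.g.val (υ t) (Q.φ (υ t) (velocity υ t)) (V t)) t := by
  have hsrc := mem_chart_source E3 (υ t)
  have hυd := hυ.mdifferentiableAt (n := ∞) (by simp)
  have h1 := (Q.g.hasDerivAt_inner hυd ((contDiffAt_coord hsrc hV).differentiableAt (by simp))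
    ((contDiffAt_coord hsrc (Q.contMDiffAt_xi_comp hυ)).differentiableAt (by simp))).const_mul Q.ε
  rw [Q.g.covDerivAlong_comp hυd
    ((contDiffAt_localRep (Q.ξ_smooth (υ t))).differentiableAt (by simp)), hQ.covDeriv_xi,
    map_smul, Q.g.symm _ (V t), smul_eq_mul] at h1
  simp only [Q.eta_eq]
  refine h1.congr_deriv ?_
  linear_combination -(Q.α (υ t) * Q.g.val (υ t) (Q.φ (υ t) (velocity υ t)) (V t)) * Q.ε_sq

end AlmostContactPseudoMetric

end ContactGeometry

namespace ContactGeometry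

open Filter Topology Set

theorem finrank_tangentSpace {M : Type*} [TopologicalSpace M] [ChartedSpace E3 M] (x : M) :
    Module.finrank ℝ (TangentSpace (𝓡 3) x) = 3 :=
  finrank_euclideanSpace_fin (𝕜 := ℝ) (n := 3)

namespace AlmostContactPseudoMetric

variable {M : Type*} [TopologicalSpace M] [ChartedSpace E3 M] [IsManifold (𝓡 3) ∞ M]
  {Q : AlmostContactPseudoMetric M} {I : Set ℝ} {υ : ℝ → M}
  {N B : (s : ℝ) → TangentSpace (𝓡 3) (υ s)} {τ : ℝ → ℝ}

theorem IsUnitSpeed.eventually_contMDiffAt (hυ : Q.IsUnitSpeed I υ) (hI : IsOpen I) {t : ℝ}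
    (ht : t ∈ I) : ∀ᶠ r in 𝓝 t, ContMDiffAt 𝓘(ℝ, ℝ) (𝓡 3) ∞ υ r := by
  filter_upwards [hI.mem_nhds ht] with r hr
  exact hυ.smooth.contMDiffAt (hI.mem_nhds hr)

/-- The signature of the Frenet frame: `N` is spacelike and `B` has the causal character of `ξ`.
Both follow from the compatibility of the connection with the metric. -/
theorem IsFrenetFrame.inner_self (hF : Q.IsFrenetFrame I υ N B τ) (hI : IsOpen I)
    (hυ : Q.IsUnitSpeed I υ) (hng : Q.IsNonGeodesic I υ) (hτ0 : ∀ s ∈ I, 0 < τ s) {t : ℝ}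
    (ht : t ∈ I) :
    Q.g.val (υ t) (N t) (N t) = 1 ∧ Q.g.val (υ t) (B t) (B t) = Q.ε := by
  have hIt := hI.mem_nhds ht
  have hsrc := mem_chart_source E3 (υ t)
  have hυe := hυ.eventually_contMDiffAt hI ht
  have hυd := hυe.self_of_nhds.mdifferentiableAt (n := ∞) (by simp)
  have hT := (contDiffAt_coord hsrc (contMDiffAt_velocity hυe)).differentiableAt (by simp)
  have hN := (contDiffAt_coord hsrc (hF.smooth_N.contMDiffAt hIt)).differentiableAt (by simp)
  have hB := (contDiffAt_coord hsrc (hF.smooth_B.contMDiffAt hIt)).differentiableAt (by simp)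
  have hconst : ∀ {f : ℝ → ℝ} {f' : ℝ}, HasDerivAt f f' t → (∀ s ∈ I, f s = 0) → f' = 0 :=
    fun hf h0 ↦ hf.unique ((hasDerivAt_const t (0 : ℝ)).congr_of_eventuallyEq
      (by filter_upwards [hIt] with s hs using h0 s hs))
  have h1 := hconst (Q.g.hasDerivAt_inner hυd hT hN) hF.orth_TN
  have h2 := hconst (Q.g.hasDerivAt_inner hυd hN hB) hF.orth_NB
  rw [hF.deriv_T t ht, hF.deriv_N t ht] at h1
  rw [hF.deriv_N t ht, hF.deriv_B t ht] at h2
  simp only [map_add, map_neg, map_smul, add_apply, neg_apply, smul_apply, smul_eq_mul,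
    hυ.unit t ht, hF.orth_TB t ht] at h1 h2
  have hNN : Q.g.val (υ t) (N t) (N t) = 1 := by
    have : Q.g.curvature υ t * (Q.g.val (υ t) (N t) (N t) - 1) = 0 := by linarith
    linarith [(mul_eq_zero.mp this).resolve_left (hng t ht).ne']
  refine ⟨hNN, ?_⟩
  rw [hNN] at h2
  have h3 : τ t * (Q.g.val (υ t) (B t) (B t) - Q.ε) = 0 := by
    linear_combination Q.ε * h2 - τ t * Q.g.val (υ t) (B t) (B t) * Q.ε_sq
  linarith [(mul_eq_zero.mp h3).resolve_left (hτ0 t ht).ne']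

/-- The acceleration is `κ N` with `N` smooth, so that `κ = g(∇_T T, N)`. -/
theorem continuousOn_curvature (hF : Q.IsFrenetFrame I υ N B τ) (hI : IsOpen I)
    (hυ : Q.IsUnitSpeed I υ) (hNN : ∀ t ∈ I, Q.g.val (υ t) (N t) (N t) = 1) :
    ContinuousOn (Q.g.curvature υ) I := fun t ht ↦ by
  have hIt := hI.mem_nhds ht
  refine ContinuousAt.continuousWithinAt ((Q.g.continuousAt_inner_acceleration
    (hυ.eventually_contMDiffAt hI ht) (hF.smooth_N.contMDiffAt hIt)).congr ?_)
  filter_upwards [hIt] with r hr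
  rw [hF.deriv_T r hr, map_smul, smul_apply, hNN r hr, smul_eq_mul, mul_one]

end AlmostContactPseudoMetric

end ContactGeometry

theorem mainTheorem3 {M : Type*} [TopologicalSpace M] [T2Space M] [ParacompactSpace M]
    [ChartedSpace (EuclideanSpace ℝ (Fin 3)) M] [IsManifold (𝓡 3) ∞ M]
    (Q : ContactGeometry.AlmostContactPseudoMetric M) (hQ : Q.IsQuasiSasakian)
    (hα : ∀ x : M, Q.α x ≠ 0)
    (I : Set ℝ) (hI_open : IsOpen I) (hI_conn : I.OrdConnected)
    (υ : ℝ → M) (hυ : Q.IsUnitSpeed I υ) (hng : Q.IsNonGeodesic I υ)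
    (m : ℝ → ℝ) (hm : ∀ s ∈ I, m s = Q.η (υ s) (ContactGeometry.velocity υ s))
    (N B : (s : ℝ) → TangentSpace (𝓡 3) (υ s)) (τ : ℝ → ℝ)
    (hF : Q.IsFrenetFrame I υ N B τ)
    (hτ : ∀ s ∈ I, τ s = |Q.α (υ s)|)
    (s₀ : ℝ) (hs₀ : s₀ ∈ I)
    (hm0 : m s₀ = 0) (hm1 : deriv m s₀ = 0) (hm2 : deriv (deriv m) s₀ = 0) :
    Q.IsLegendre I υ := by
  have hτ0 : ∀ s ∈ I, 0 < τ s := fun s hs ↦ by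
    rw [hτ s hs]
    exact abs_pos.mpr (hα _)
  have hframe := fun s hs ↦ hF.inner_self hI_open hυ hng hτ0 (t := s) hs
  have hκ := ContactGeometry.AlmostContactPseudoMetric.continuousOn_curvature hF hI_open hυ
    fun t ht ↦ (hframe t ht).1
  have hυs : ∀ t ∈ I, ContMDiffAt 𝓘(ℝ, ℝ) (𝓡 3) ∞ υ t := fun t ht ↦
    (hυ.eventually_contMDiffAt hI_open ht).self_of_nhds
  have hN := fun t ht ↦ hF.smooth_N.contMDiffAt (hI_open.mem_nhds (x := t) ht)
  have hB := fun t ht ↦ hF.smooth_B.contMDiffAt (hI_open.mem_nhds (x := t) ht)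
  set n : ℝ → ℝ := fun t ↦ Q.η (υ t) (N t) with hn_def
  set b : ℝ → ℝ := fun t ↦ Q.η (υ t) (B t) with hb_def
  have hmI : ∀ t ∈ I, m =ᶠ[nhds t] fun s ↦ Q.η (υ s) (ContactGeometry.velocity υ s) :=
    fun t ht ↦ by filter_upwards [hI_open.mem_nhds ht] with s hs using hm s hs
  have hmd : ∀ t ∈ I, HasDerivAt m (Q.g.curvature υ t * n t) t := fun t ht ↦ by
    have h := hQ.hasDerivAt_eta (hυs t ht)
      (ContactGeometry.contMDiffAt_velocity (hυ.eventually_contMDiffAt hI_open ht))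
    refine (h.congr_of_eventuallyEq (hmI t ht)).congr_deriv ?_
    rw [hF.deriv_T t ht, map_smul, (Q.isContactAlgebra (υ t)).inner_phi_self, smul_eq_mul,
      mul_zero, sub_zero]
  have hns : ∀ t ∈ I, ContDiffAt ℝ ∞ n t := fun t ht ↦ Q.contDiffAt_eta_comp (hυs t ht) (hN t ht)
  have hnd : ∀ t ∈ I, HasDerivAt n (deriv n t) t := fun t ht ↦
    ((hns t ht).differentiableAt (by simp)).hasDerivAt
  have hn' : ContinuousOn (deriv n) I := fun t ht ↦
    (ContactGeometry.contDiffAt_deriv (hns t ht)).continuousAt.continuousWithinAt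
  have hbc : ContinuousOn b I := fun t ht ↦
    (Q.contDiffAt_eta_comp (hυs t ht) (hB t ht)).continuousAt.continuousWithinAt
  have hunit : ∀ t ∈ I, Q.ε * m t ^ 2 + Q.ε * n t ^ 2 + b t ^ 2 = 1 := fun t ht ↦ by
    rw [hm t ht]
    exact (Q.isContactAlgebra (υ t)).eta_frame (ContactGeometry.finrank_tangentSpace (υ t))
      (hυ.unit t ht) (hframe t ht).1 (hframe t ht).2 (hF.orth_TN t ht)
      (hF.orth_TB t ht) (hF.orth_NB t ht)
  -- `n' + κ m - ε τ b = -α g(φ T, N)`, and `g(φ T, N) = ± b` by the algebra of the frame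
  have hdich : ∀ t ∈ I, 1 - Q.ε * m t ^ 2 ≠ 0 →
      (deriv n t + Q.g.curvature υ t * m t - Q.ε * τ t * b t) ^ 2 = τ t ^ 2 * b t ^ 2 := by
    intro t ht h1
    rw [hm t ht] at h1
    have h2 := (hnd t ht).unique (hQ.hasDerivAt_eta (hυs t ht) (hN t ht))
    rw [hF.deriv_N t ht, map_add, map_neg, map_smul, map_smul, smul_eq_mul, smul_eq_mul,
      ← hm t ht] at h2
    have h3 := (Q.isContactAlgebra (υ t)).inner_phi_sq
      (ContactGeometry.finrank_tangentSpace (υ t)) (hυ.unit t ht)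
      (hframe t ht).1 (hframe t ht).2 (hF.orth_TN t ht) (hF.orth_TB t ht) (hF.orth_NB t ht) h1
    have h4 : deriv n t + Q.g.curvature υ t * m t - Q.ε * τ t * b t =
        -(Q.α (υ t) * Q.g.val (υ t) (Q.φ (υ t) (ContactGeometry.velocity υ t)) (N t)) := by
      rw [h2]
      ring
    rw [h4, neg_sq, mul_pow, h3, hτ t ht, sq_abs]
  have hκ0 := (hng s₀ hs₀).ne'
  have hn0 : n s₀ = 0 := by
    rw [(hmd s₀ hs₀).deriv] at hm1
    exact (mul_eq_zero.mp hm1).resolve_left hκ0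
  have hn1 : deriv n s₀ = 0 := by
    have h1 : deriv m =ᶠ[nhds s₀] fun t ↦ Q.g.curvature υ t * n t := by
      filter_upwards [hI_open.mem_nhds hs₀] with t ht using (hmd t ht).deriv
    rw [h1.deriv_eq, (ContactGeometry.hasDerivAt_mul_of_eq_zero
      (hκ.continuousAt (hI_open.mem_nhds hs₀)) (hnd s₀ hs₀) hn0).deriv] at hm2
    exact (mul_eq_zero.mp hm2).resolve_left hκ0
  intro t ht
  rw [← hm t ht]
  exact ContactGeometry.eq_zero_of_frenet hI_open hI_conn Q.ε_sq hmd hnd hn' hκ hbc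
    hF.smooth_τ.continuousOn hτ0 hunit hdich hs₀ hm0 hn0 hn1 t ht
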